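/- **Conventions.** Multiplicities $k,k'$ range over $\{1,2,3,\dots\}\cup\{\infty\}$; credit amounts $a,c,d,\ell$ range over $\mathbb N\cup\{\infty\}$, with $\infty\cdot 0=0$ and $\infty\cdot a=\infty$ otherwise. Let $\overline{\mathbb Z}=\mathbb Z\cup\{\pm\infty\}$ with $\infty+x=\infty$ for all $x$ (also for $x=-\infty$), $-\infty+x=-\infty$ for $x\neq\infty$, and with $\infty\cdot x=-\infty,0,\infty$ according to whether $x<0$, $x=0$, $x>0$. **The language $\lambda^A$.** Types are $A::=1\mid A\otimes A\mid A\oplus A\mid A\mathbin{\&}A\mid A\multimap A\mid {!}^k_\ell A\mid\mathbb N\mid\mathrm{list}\,A$. A resource term for a context $\Gamma=x_1{:}A_1,\dots,x_n{:}A_n$ is $f=a_1x_1+\dots+a_nx_n+\ell$; resource terms are added, scaled and compared coefficientwise. The judgment $\Gamma\vdash_f M:A$ is generated by the following rules. - $\Gamma\vdash_f x:A$ if $x{:}A\in\Gamma$ and $f\ge x$. For every $f$: $\Gamma\vdash_f():1$, $\Gamma\vdash_f 0:\mathbb N$, $\Gamma\vdash_f[\,]:\mathrm{list}\,A$. - If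 $\Gamma\vdash_f M:A$ and $\Gamma\vdash_g N:B$, then $\Gamma\vdash_{f+g}(M,N):A\otimes B$. If $\Gamma\vdash_f M:A\otimes B$ and $\Gamma,x{:}A,y{:}B\vdash_{g+kx+ky}N:C$, then $\Gamma\vdash_{g+kf}\mathtt{split}_k(M,x.y.N):C$. - If $\Gamma\vdash_fM:A$ then $\Gamma\vdash_f\mathtt{inl}\,M:A\oplus B$; if $\Gamma\vdash_fM:B$ then $\Gamma\vdash_f\mathtt{inr}\,M:A\oplus B$. If $\Gamma\vdash_fM:A\oplus B$, $\Gamma,x{:}A\vdash_{g+kx}N_1:C$ and $\Gamma,y{:}B\vdash_{g+ky}N_2:C$, then $\Gamma\vdash_{g+kf}\mathtt{case}_k(M,x.N_1,y.N_2):C$. - If $\Gamma\vdash_fM:A$ and $\Gamma\vdash_fN:B$, then $\Gamma\vdash_f\langle M,N\rangle:A\mathbin\&B$. If $\Gamma\vdash_fM:A_1\mathbin\&A_2$, then $\Gamma\vdash_f\pi_iM:A_i$. - If $\Gamma,x{:}A\vdash_{f+x}M:B$ then $\Gamma\vdash_f\lambda x.M:A\multimap B$. If $\Gamma\vdash_fM:A\multimap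 B$ and $\Gamma\vdash_gN:A$ then $\Gamma\vdash_{f+g}M\,N:B$. - If $\Gamma\vdash_fM:A$ and $g\ge kf+\ell$, then $\Gamma\vdash_g\mathtt{save}^k_\ell M:{!}^k_\ell A$. If $\Gamma\vdash_fM:{!}^k_\ell A$ and $\Gamma,x{:}A\vdash_{g+k'kx+k'\ell}N:C$, then $\Gamma\vdash_{g+k'f}\mathtt{transfer}_{k'}\,{!}^k_\ell x=M\ \mathtt{to}\ N:C$. - If $\Gamma\vdash_fM:A$ then $\Gamma\vdash_f\mathtt{tick};M:A$ and $\Gamma\vdash_{f+\ell}\mathtt{spend}_\ell M:A$. If $\Gamma\vdash_{f+\ell}M:A$ then $\Gamma\vdash_f\mathtt{create}_\ell M:A$. - If $\Gamma\vdash_fM:\mathbb N$ then $\Gamma\vdash_fS(M):\mathbb N$. If $\Gamma\vdash_fM:\mathbb N$, $\Gamma\vdash_gN_1:1\multimap C$ and $\Gamma\vdash_hN_2:{!}^\infty_0(\mathbb N\otimes(1\multimap C)\multimap C)$, then $\Gamma\vdash_{f+g+h}\mathtt{nrec}(M,N_1,N_2):C$. - If $\Gamma\vdash_fM:A$ and $\Gamma\vdash_gN:\mathrm{list}\,A$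 then $\Gamma\vdash_{f+g}M::N:\mathrm{list}\,A$. If $\Gamma\vdash_fM:\mathrm{list}\,A$, $\Gamma\vdash_gN_1:1\multimap C$ and $\Gamma\vdash_hN_2:{!}^\infty_0(A\otimes(\mathrm{list}\,A\mathbin\&C)\multimap C)$, then $\Gamma\vdash_{f+g+h}\mathtt{lrec}(M,N_1,N_2):C$. **Evaluation.** $M\downarrow^{(n,r)}v$, with $n\in\mathbb N$ (ticks) and $r\in\overline{\mathbb Z}$ (credits created minus credits spent), is the call-by-value big-step semantics on closed terms. The terms $()$, $0$, $[\,]$, $\lambda x.M$ and $\langle M,N\rangle$ evaluate to themselves with cost $(0,0)$; the other constructors evaluate their arguments. Costs of subevaluations are added, except as follows. $\mathtt{tick}$ adds $1$ to $n$; $\mathtt{create}_\ell$ and $\mathtt{spend}_\ell$ add $\ell$, respectively $-\ell$, to $r$. If $M\downarrow^{(n,r)}v$ then $\mathtt{save}^k_\ell M\downarrow^{(n,kr)}\mathtt{save}^k_\ell v$. In $\mathtt{split}_k$, $\mathtt{case}_k$ and $\mathtt{transfer}_k$, if the scrutinee costs $(n_1,r_1)$ and the instantiated body costs $(n_2,r_2)$,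 the total is $(n_1+n_2,\,kr_1+r_2)$; $\mathtt{transfer}_{k'}\,{!}^k_\ell x=M\ \mathtt{to}\ N$ evaluates $M$ to $\mathtt{save}^k_\ell v$ and continues with $N[v/x]$. $\mathtt{nrec}(M,N_1,N_2)$ evaluates $M$, then $N_1$ to $\lambda x.N_1'$ and $N_2$ to $\mathtt{save}^\infty_0(\lambda x.N_2')$; it continues with $N_1'[()/x]$ if $M$ gave $0$, and with $N_2'[(v,\lambda z.\mathtt{nrec}(v,\lambda x.N_1',\mathtt{save}^\infty_0\lambda x.N_2'))/x]$ if $M$ gave $S(v)$. $\mathtt{lrec}$ is analogous, continuing with $N_1'[()/x]$ for $[\,]$ and with $N_2'[(v_1,\langle v_2,\mathtt{lrec}(v_2,\lambda x.N_1',\mathtt{save}^\infty_0\lambda x.N_2')\rangle)/x]$ for $v_1::v_2$. **The recurrence language $\lambda^{\mathbb C}$.** This is the simply typed $\lambda$-calculus with types $\mathbb C$, $1$, $\times$, $+$, $\to$, $\mathbb N$, $\mathrm{list}$ and structural recursors $\mathtt{nrec}(E,E_1,E_2):T$ (for $E:\mathbb N$, $E_1:1\to T$, $E_2:\mathbb N\times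 T\to T$) and $\mathtt{lrec}(E,E_1,E_2):T$ (for $E:\mathrm{list}\,T'$, $E_1:1\to T$, $E_2:T'\times(\mathrm{list}\,T'\times T)\to T$). Terms of the cost type $\mathbb C$ include constants from $\overline{\mathbb Z}$, sums $E+E'$ and multiples $k\cdot E$. The judgment $\Gamma\vdash E\le_TE'$ on well-typed terms is the least preorder that is a congruence in the principal positions of elimination forms, places every $\beta$-reduct below its redex, makes $+$ and $k\cdot(-)$ on $\mathbb C$ monotone and $(\mathbb C,+,0)$ a commutative monoid, and contains the order, sums and multiples of the constants. **Extraction.** Potential types are $\langle\!\langle1\rangle\!\rangle=1$, $\langle\!\langle A\otimes B\rangle\!\rangle=\langle\!\langle A\rangle\!\rangle\times\langle\!\langle B\rangle\!\rangle$, $\langle\!\langle A\oplus B\rangle\!\rangle=\langle\!\langle A\rangle\!\rangle+\langle\!\langle B\rangle\!\rangle$, $\langle\!\langle A\mathbin\&B\rangle\!\rangle=\|A\|\times\|B\|$, $\langle\!\langle A\multimap B\rangle\!\rangle=\langle\!\langle A\rangle\!\rangle\to\|B\|$, $\langle\!\langle{!}^k_\ell A\rangle\!\rangle=\langle\!\langle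 A\rangle\!\rangle$, $\langle\!\langle\mathbb N\rangle\!\rangle=\mathbb N$, $\langle\!\langle\mathrm{list}\,A\rangle\!\rangle=\mathrm{list}\,\langle\!\langle A\rangle\!\rangle$, where $\|A\|=\mathbb C\times\langle\!\langle A\rangle\!\rangle$. Write $E_c=\pi_1E$, $E_p=\pi_2E$ and $E+_cE'=(E+E'_c,E'_p)$. The extraction $\|M\|$ is given by: - $\|x\|=(0,x)$; $\|()\|=(0,())$; $\|0\|=(0,0)$; $\|[\,]\|=(0,[\,])$; $\|\lambda x.M\|=(0,\lambda x.\|M\|)$; $\|\langle M,N\rangle\|=(0,(\|M\|,\|N\|))$; - $\|(M,N)\|=(\|M\|_c+\|N\|_c,(\|M\|_p,\|N\|_p))$; $\|M::N\|=(\|M\|_c+\|N\|_c,\|M\|_p::\|N\|_p)$; $\|F\,M\|=(\|M\|_c,F\,\|M\|_p)$ for $F=\mathtt{inl},\mathtt{inr},S$; - $\|\mathtt{split}_k(M,x.y.N)\|=k\|M\|_c+_c\|N\|[\pi_1\|M\|_p/x,\pi_2\|M\|_p/y]$; - $\|\mathtt{case}_k(M,x.N_1,y.N_2)\|=k\|M\|_c+_c\mathtt{case}(\|M\|_p,x.\|N_1\|,y.\|N_2\|)$;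 - $\|\pi_iM\|=\|M\|_c+_c\pi_i\|M\|_p$; $\|M\,N\|=(\|M\|_c+\|N\|_c)+_c\|M\|_p\,\|N\|_p$; - $\|\mathtt{save}^k_\ell M\|=(k\|M\|_c,\|M\|_p)$; $\|\mathtt{transfer}_{k'}\,{!}^k_\ell x=M\ \mathtt{to}\ N\|=k'\|M\|_c+_c\|N\|[\|M\|_p/x]$; - $\|\mathtt{tick};M\|=1+_c\|M\|$; $\|\mathtt{create}_\ell M\|=\ell+_c\|M\|$; $\|\mathtt{spend}_\ell M\|=(-\ell)+_c\|M\|$; - $\|\mathtt{nrec}(M,N_1,N_2)\|=(\|M\|_c+\|N_1\|_c+\|N_2\|_c)+_c\mathtt{nrec}(\|M\|_p,\|N_1\|_p,\lambda p.\|N_2\|_p(\pi_1p,\lambda z.\pi_2p))$; - $\|\mathtt{lrec}(M,N_1,N_2)\|=(\|M\|_c+\|N_1\|_c+\|N_2\|_c)+_c\mathtt{lrec}(\|M\|_p,\|N_1\|_p,\lambda p.\|N_2\|_p(\pi_1p,((0,\pi_1\pi_2p),\pi_2\pi_2p)))$. **Bounding relation.** For closed terms, $M\sqsubseteq^{A,a}E$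 means that $\cdot\vdash_aM:A$, $\cdot\vdash E:\|A\|$, and whenever $M\downarrow^{(n,r)}v$ we have $n+r\le_{\mathbb C}E_c$, $a+r\in\mathbb N\cup\{\infty\}$ and $v\sqsubseteq_{\mathrm{val}}^{A,a+r}E_p$. The relation $v\sqsubseteq_{\mathrm{val}}^{A,a}E$ means that $\cdot\vdash_av:A$, $\cdot\vdash E:\langle\!\langle A\rangle\!\rangle$ and, by recursion on $A$: - $A=1$: $v=()$ and $()\le E$; - $A=A_1\otimes A_2$: $v=(v_1,v_2)$ and $v_i\sqsubseteq_{\mathrm{val}}^{A_i,a_i}\pi_iE$ ($i=1,2$) for some $a_1+a_2=a$; - $A=A_1\oplus A_2$: for some $E'$, either $v=\mathtt{inl}\,w$, $\mathtt{inl}\,E'\le E$ and $w\sqsubseteq_{\mathrm{val}}^{A_1,a}E'$, or $v=\mathtt{inr}\,w$, $\mathtt{inr}\,E'\le E$ and $w\sqsubseteq_{\mathrm{val}}^{A_2,a}E'$; - $A=A_1\mathbin\&A_2$: $v=\langle M_1,M_2\rangle$ and $M_i\sqsubseteq^{A_i,a}\pi_iE$ for $i=1,2$; - $A=B\multimap C$: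 $v=\lambda x.M$, and $M[w/x]\sqsubseteq^{C,a+d}E\,E'$ whenever $w\sqsubseteq_{\mathrm{val}}^{B,d}E'$; - $A={!}^k_\ell B$: $v=\mathtt{save}^k_\ell w$ and, for some $d$, $kd+\ell\le a$ and $w\sqsubseteq_{\mathrm{val}}^{B,d}E$; - $A=\mathbb N$ (by induction on $v$): $v=0$ and $0\le E$, or $v=S(w)$ and, for some $E'$, $S(E')\le E$ and $w\sqsubseteq_{\mathrm{val}}^{\mathbb N,a}E'$; - $A=\mathrm{list}\,B$ (by induction on $v$): $v=[\,]$ and $[\,]\le E$, or $v=v_1::v_2$ and, for some $E_1,E_2$ and $a_1+a_2=a$, $E_1::E_2\le E$, $v_1\sqsubseteq_{\mathrm{val}}^{B,a_1}E_1$ and $v_2\sqsubseteq_{\mathrm{val}}^{\mathrm{list}\,B,a_2}E_2$. **Theorem (Bounding Theorem).** If $\Gamma\vdash_fM:A$, then $M\sqsubseteq\|M\|$. That is, for every assignment $\sigma$ of credit amounts to the variables of $\Gamma$ and all closing substitutions $\theta$ (into $\lambda^A$) and $\Theta$ (into $\lambda^{\mathbb C}$) such that $\theta(x)\sqsubseteq_{\mathrm{val}}^{B,\sigma(x)}\Theta(x)$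 for every $x{:}B\in\Gamma$, we have $$M[\theta]\sqsubseteq^{A,f[\sigma]}\|M\|[\Theta],$$ where $f[\sigma]=\sum_ia_i\sigma(x_i)+\ell$ for $f=\sum_ia_ix_i+\ell$. -/

import Mathlib

/-!
The affine intermediate language `λ^A`, the recurrence language `λ^ℂ`, amortized recurrence
extraction, and the bounding logical relation.  Both languages are given as well-scoped
de Bruijn syntax: `ATm n` and `CTm n` are terms with at most `n` free variables, and variable
`0` is the most recently bound one.
-/

namespace AmortRec

noncomputable section

/-! ### Numbers -/

/-- Multiplicities `k`: positive natural numbers or `∞`. -/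
abbrev Mult : Type := {k : ℕ∞ // k ≠ 0}

/-- The multiplicity `∞`. -/
def Mult.inf : Mult := ⟨⊤, by simp⟩

/-- Integers extended by `∞` and `-∞`, with `∞` absorbing for addition (so `∞ + (-∞) = ∞`).
They serve as the credit component `r` of operational costs and as the cost constants. -/
abbrev ZInf : Type := WithTop (WithBot ℤ)

/-- The inclusion of (possibly infinite) credit amounts into the extended integers. -/
def credit (l : ℕ∞) : ZInf := ENat.map (fun m : ℕ => (((m : ℤ)) : WithBot ℤ)) l

/-- The extended integer `-l`. -/
def negCredit (l : ℕ∞) : ZInf :=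
  ENat.recTopCoe (C := fun _ => ZInf) ⊥ (fun m : ℕ => (((-(m : ℤ) : ℤ) : WithBot ℤ) : ZInf)) l

/-- The product `k · r`, with `∞ · 0 = 0` and `∞ · r = ±∞` according to the sign of `r ≠ 0`. -/
def scale (k : Mult) (r : ZInf) : ZInf :=
  ENat.recTopCoe (C := fun _ => ZInf)
    (if r < 0 then ⊥ else if r = 0 then 0 else ⊤) (fun m : ℕ => m • r) k.1

/-! ### The intermediate language: types and terms -/

/-- Types of `λ^A`. -/
inductive Ty : Type
  | one : Ty
  | tensor : Ty → Ty → Ty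
  | plus : Ty → Ty → Ty
  | amp : Ty → Ty → Ty
  | lolli : Ty → Ty → Ty
  | bang : Mult → ℕ∞ → Ty → Ty
  | nat : Ty
  | list : Ty → Ty

/-- Terms of `λ^A`. -/
inductive ATm : ℕ → Type
  | var {n : ℕ} (i : Fin n) : ATm n
  | unit {n : ℕ} : ATm n
  | pair {n : ℕ} (M N : ATm n) : ATm n
  /-- `split_k M to x, y in N`; in `N`, `y` is variable `0` and `x` is variable `1`. -/
  | split {n : ℕ} (k : Mult) (M : ATm n) (N : ATm (n + 2)) : ATm n
  | inl {n : ℕ} (M : ATm n) : ATm n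
  | inr {n : ℕ} (M : ATm n) : ATm n
  /-- `case_k (M, x. N₁, y. N₂)`. -/
  | case {n : ℕ} (k : Mult) (M : ATm n) (N₁ N₂ : ATm (n + 1)) : ATm n
  /-- The lazy pair `⟨M, N⟩` of type `A & B`. -/
  | ampPair {n : ℕ} (M N : ATm n) : ATm n
  | fst {n : ℕ} (M : ATm n) : ATm n
  | snd {n : ℕ} (M : ATm n) : ATm n
  | lam {n : ℕ} (M : ATm (n + 1)) : ATm n
  | app {n : ℕ} (M N : ATm n) : ATm n
  /-- `save^k_l M`. -/
  | save {n : ℕ} (k : Mult) (l : ℕ∞) (M : ATm n) : ATm n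
  /-- `transfer_{k'} !^k_l x = M to N`. -/
  | transfer {n : ℕ} (k' k : Mult) (l : ℕ∞) (M : ATm n) (N : ATm (n + 1)) : ATm n
  | tick {n : ℕ} (M : ATm n) : ATm n
  | create {n : ℕ} (l : ℕ∞) (M : ATm n) : ATm n
  | spend {n : ℕ} (l : ℕ∞) (M : ATm n) : ATm n
  | zero {n : ℕ} : ATm n
  | succ {n : ℕ} (M : ATm n) : ATm n
  | nrec {n : ℕ} (M N₁ N₂ : ATm n) : ATm n
  | nil {n : ℕ} : ATm n
  | cons {n : ℕ} (M N : ATm n) : ATm n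
  | lrec {n : ℕ} (M N₁ N₂ : ATm n) : ATm n

/-- Extension of a renaming under a binder. -/
def liftRen {n m : ℕ} (ρ : Fin n → Fin m) : Fin (n + 1) → Fin (m + 1) :=
  Fin.cons 0 (fun i => (ρ i).succ)

def ATm.rename : {n m : ℕ} → (Fin n → Fin m) → ATm n → ATm m
  | _, _, ρ, .var i => .var (ρ i)
  | _, _, _, .unit => .unit
  | _, _, ρ, .pair M N => .pair (M.rename ρ) (N.rename ρ)
  | _, _, ρ, .split k M N => .split k (M.rename ρ) (N.rename (liftRen (liftRen ρ)))
  | _, _, ρ, .inl M => .inl (M.rename ρ)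
  | _, _, ρ, .inr M => .inr (M.rename ρ)
  | _, _, ρ, .case k M N₁ N₂ =>
      .case k (M.rename ρ) (N₁.rename (liftRen ρ)) (N₂.rename (liftRen ρ))
  | _, _, ρ, .ampPair M N => .ampPair (M.rename ρ) (N.rename ρ)
  | _, _, ρ, .fst M => .fst (M.rename ρ)
  | _, _, ρ, .snd M => .snd (M.rename ρ)
  | _, _, ρ, .lam M => .lam (M.rename (liftRen ρ))
  | _, _, ρ, .app M N => .app (M.rename ρ) (N.rename ρ)
  | _, _, ρ, .save k l M => .save k l (M.rename ρ)
  | _, _, ρ, .transfer k' k l M N => .transfer k' k l (M.rename ρ) (N.rename (liftRen ρ))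
  | _, _, ρ, .tick M => .tick (M.rename ρ)
  | _, _, ρ, .create l M => .create l (M.rename ρ)
  | _, _, ρ, .spend l M => .spend l (M.rename ρ)
  | _, _, _, .zero => .zero
  | _, _, ρ, .succ M => .succ (M.rename ρ)
  | _, _, ρ, .nrec M N₁ N₂ => .nrec (M.rename ρ) (N₁.rename ρ) (N₂.rename ρ)
  | _, _, _, .nil => .nil
  | _, _, ρ, .cons M N => .cons (M.rename ρ) (N.rename ρ)
  | _, _, ρ, .lrec M N₁ N₂ => .lrec (M.rename ρ) (N₁.rename ρ) (N₂.rename ρ)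

def ATm.weaken {n : ℕ} (M : ATm n) : ATm (n + 1) := M.rename Fin.succ

/-- Extension of a substitution under a binder. -/
def ATm.lift {n m : ℕ} (θ : Fin n → ATm m) : Fin (n + 1) → ATm (m + 1) :=
  Fin.cons (.var 0) (fun i => (θ i).weaken)

/-- Simultaneous capture-avoiding substitution `M[θ]`. -/
def ATm.subst : {n m : ℕ} → (Fin n → ATm m) → ATm n → ATm m
  | _, _, θ, .var i => θ i
  | _, _, _, .unit => .unit
  | _, _, θ, .pair M N => .pair (M.subst θ) (N.subst θ)
  | _, _, θ, .split k M N => .split k (M.subst θ) (N.subst (ATm.lift (ATm.lift θ)))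
  | _, _, θ, .inl M => .inl (M.subst θ)
  | _, _, θ, .inr M => .inr (M.subst θ)
  | _, _, θ, .case k M N₁ N₂ =>
      .case k (M.subst θ) (N₁.subst (ATm.lift θ)) (N₂.subst (ATm.lift θ))
  | _, _, θ, .ampPair M N => .ampPair (M.subst θ) (N.subst θ)
  | _, _, θ, .fst M => .fst (M.subst θ)
  | _, _, θ, .snd M => .snd (M.subst θ)
  | _, _, θ, .lam M => .lam (M.subst (ATm.lift θ))
  | _, _, θ, .app M N => .app (M.subst θ) (N.subst θ)
  | _, _, θ, .save k l M => .save k l (M.subst θ)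
  | _, _, θ, .transfer k' k l M N => .transfer k' k l (M.subst θ) (N.subst (ATm.lift θ))
  | _, _, θ, .tick M => .tick (M.subst θ)
  | _, _, θ, .create l M => .create l (M.subst θ)
  | _, _, θ, .spend l M => .spend l (M.subst θ)
  | _, _, _, .zero => .zero
  | _, _, θ, .succ M => .succ (M.subst θ)
  | _, _, θ, .nrec M N₁ N₂ => .nrec (M.subst θ) (N₁.subst θ) (N₂.subst θ)
  | _, _, _, .nil => .nil
  | _, _, θ, .cons M N => .cons (M.subst θ) (N.subst θ)
  | _, _, θ, .lrec M N₁ N₂ => .lrec (M.subst θ) (N₁.subst θ) (N₂.subst θ)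

/-- `N[M/x]` for the most recently bound variable `x`. -/
def ATm.inst {n : ℕ} (N : ATm (n + 1)) (M : ATm n) : ATm n :=
  N.subst (Fin.cons M ATm.var)

/-- `N[M₁/x, M₂/y]`, where `x` is variable `1` and `y` is variable `0`. -/
def ATm.inst₂ {n : ℕ} (N : ATm (n + 2)) (M₁ M₂ : ATm n) : ATm n :=
  N.subst (Fin.cons M₂ (Fin.cons M₁ ATm.var))

/-! ### The intermediate language: resource terms and typing -/

/-- Contexts of `λ^A` with `n` variables. -/
abbrev Ctx (n : ℕ) : Type := Fin n → Ty

/-- Extension `Γ, x : A` of a context. -/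
def Ctx.ext {n : ℕ} (Γ : Ctx n) (A : Ty) : Ctx (n + 1) := Fin.cons A Γ

/-- Resource terms `a₁ x₁ + ⋯ + aₙ xₙ + l`, as the coefficients together with the bank `l`.
Sums, multiples `k • f` and the order `f ≤ g` are coefficientwise (with `∞ * 0 = 0`). -/
abbrev Res (n : ℕ) : Type := (Fin n → ℕ∞) × ℕ∞

/-- The resource term `x`. -/
def Res.var {n : ℕ} (i : Fin n) : Res n := (Pi.single i 1, 0)

/-- The constant resource term `l`. -/
def Res.bank {n : ℕ} (l : ℕ∞) : Res n := (0, l)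

/-- The resource term `f + a x` for a new variable `x`. -/
def Res.ext {n : ℕ} (f : Res n) (a : ℕ∞) : Res (n + 1) := (Fin.cons a f.1, f.2)

/-- The value `f[σ]` of a resource term when each variable `x` stands for `σ x` credits. -/
def Res.eval {n : ℕ} (f : Res n) (σ : Fin n → ℕ∞) : ℕ∞ := (∑ i, f.1 i * σ i) + f.2

/-- The typing judgment `Γ ⊢_f M : A` of `λ^A`. -/
inductive HasTy : {n : ℕ} → Ctx n → Res n → ATm n → Ty → Prop
  | var {n : ℕ} {Γ : Ctx n} {f : Res n} (i : Fin n) :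
      Res.var i ≤ f → HasTy Γ f (.var i) (Γ i)
  | unit {n : ℕ} {Γ : Ctx n} {f : Res n} : HasTy Γ f .unit .one
  | pair {n : ℕ} {Γ : Ctx n} {f g : Res n} {M N : ATm n} {A B : Ty} :
      HasTy Γ f M A → HasTy Γ g N B → HasTy Γ (f + g) (.pair M N) (.tensor A B)
  | split {n : ℕ} {Γ : Ctx n} {f g : Res n} {k : Mult} {M : ATm n} {N : ATm (n + 2)}
      {A B C : Ty} :
      HasTy Γ f M (.tensor A B) →
      HasTy ((Γ.ext A).ext B) ((g.ext k.1).ext k.1) N C →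
      HasTy Γ (g + k.1 • f) (.split k M N) C
  | inl {n : ℕ} {Γ : Ctx n} {f : Res n} {M : ATm n} {A B : Ty} :
      HasTy Γ f M A → HasTy Γ f (.inl M) (.plus A B)
  | inr {n : ℕ} {Γ : Ctx n} {f : Res n} {M : ATm n} {A B : Ty} :
      HasTy Γ f M B → HasTy Γ f (.inr M) (.plus A B)
  | case {n : ℕ} {Γ : Ctx n} {f g : Res n} {k : Mult} {M : ATm n} {N₁ N₂ : ATm (n + 1)}
      {A B C : Ty} :
      HasTy Γ f M (.plus A B) →
      HasTy (Γ.ext A) (g.ext k.1) N₁ C →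
      HasTy (Γ.ext B) (g.ext k.1) N₂ C →
      HasTy Γ (g + k.1 • f) (.case k M N₁ N₂) C
  | ampPair {n : ℕ} {Γ : Ctx n} {f : Res n} {M N : ATm n} {A B : Ty} :
      HasTy Γ f M A → HasTy Γ f N B → HasTy Γ f (.ampPair M N) (.amp A B)
  | fst {n : ℕ} {Γ : Ctx n} {f : Res n} {M : ATm n} {A B : Ty} :
      HasTy Γ f M (.amp A B) → HasTy Γ f (.fst M) A
  | snd {n : ℕ} {Γ : Ctx n} {f : Res n} {M : ATm n} {A B : Ty} :
      HasTy Γ f M (.amp A B) → HasTy Γ f (.snd M) B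
  | lam {n : ℕ} {Γ : Ctx n} {f : Res n} {M : ATm (n + 1)} {A B : Ty} :
      HasTy (Γ.ext A) (f.ext 1) M B → HasTy Γ f (.lam M) (.lolli A B)
  | app {n : ℕ} {Γ : Ctx n} {f g : Res n} {M N : ATm n} {A B : Ty} :
      HasTy Γ f M (.lolli A B) → HasTy Γ g N A → HasTy Γ (f + g) (.app M N) B
  | save {n : ℕ} {Γ : Ctx n} {f g : Res n} {k : Mult} {l : ℕ∞} {M : ATm n} {A : Ty} :
      HasTy Γ f M A → k.1 • f + Res.bank l ≤ g → HasTy Γ g (.save k l M) (.bang k l A)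
  | transfer {n : ℕ} {Γ : Ctx n} {f g : Res n} {k' k : Mult} {l : ℕ∞} {M : ATm n}
      {N : ATm (n + 1)} {A C : Ty} :
      HasTy Γ f M (.bang k l A) →
      HasTy (Γ.ext A) ((g + Res.bank (k'.1 * l)).ext (k'.1 * k.1)) N C →
      HasTy Γ (g + k'.1 • f) (.transfer k' k l M N) C
  | tick {n : ℕ} {Γ : Ctx n} {f : Res n} {M : ATm n} {A : Ty} :
      HasTy Γ f M A → HasTy Γ f (.tick M) A
  | create {n : ℕ} {Γ : Ctx n} {f : Res n} {l : ℕ∞} {M : ATm n} {A : Ty} :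
      HasTy Γ (f + Res.bank l) M A → HasTy Γ f (.create l M) A
  | spend {n : ℕ} {Γ : Ctx n} {f : Res n} {l : ℕ∞} {M : ATm n} {A : Ty} :
      HasTy Γ f M A → HasTy Γ (f + Res.bank l) (.spend l M) A
  | zero {n : ℕ} {Γ : Ctx n} {f : Res n} : HasTy Γ f .zero .nat
  | succ {n : ℕ} {Γ : Ctx n} {f : Res n} {M : ATm n} :
      HasTy Γ f M .nat → HasTy Γ f (.succ M) .nat
  | nrec {n : ℕ} {Γ : Ctx n} {f g h : Res n} {M N₁ N₂ : ATm n} {C : Ty} :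
      HasTy Γ f M .nat →
      HasTy Γ g N₁ (.lolli .one C) →
      HasTy Γ h N₂ (.bang Mult.inf 0 (.lolli (.tensor .nat (.lolli .one C)) C)) →
      HasTy Γ (f + g + h) (.nrec M N₁ N₂) C
  | nil {n : ℕ} {Γ : Ctx n} {f : Res n} {A : Ty} : HasTy Γ f .nil (.list A)
  | cons {n : ℕ} {Γ : Ctx n} {f g : Res n} {M N : ATm n} {A : Ty} :
      HasTy Γ f M A → HasTy Γ g N (.list A) → HasTy Γ (f + g) (.cons M N) (.list A)
  | lrec {n : ℕ} {Γ : Ctx n} {f g h : Res n} {M N₁ N₂ : ATm n} {A C : Ty} :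
      HasTy Γ f M (.list A) →
      HasTy Γ g N₁ (.lolli .one C) →
      HasTy Γ h N₂ (.bang Mult.inf 0 (.lolli (.tensor A (.amp (.list A) C)) C)) →
      HasTy Γ (f + g + h) (.lrec M N₁ N₂) C

/-! ### The intermediate language: operational semantics -/

/-- Big-step evaluation `M ↓^(n, r) v` of closed terms: `n` is the number of ticks and `r` the
net number of credits created. -/
inductive Eval : ATm 0 → ℕ → ZInf → ATm 0 → Prop
  | unit : Eval .unit 0 0 .unit
  | pair {M N v w : ATm 0} {n₁ n₂ : ℕ} {r₁ r₂ : ZInf} :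
      Eval M n₁ r₁ v → Eval N n₂ r₂ w →
      Eval (.pair M N) (n₁ + n₂) (r₁ + r₂) (.pair v w)
  | split {k : Mult} {M v₁ v₂ w : ATm 0} {N : ATm 2} {n₁ n₂ : ℕ} {r₁ r₂ : ZInf} :
      Eval M n₁ r₁ (.pair v₁ v₂) → Eval (N.inst₂ v₁ v₂) n₂ r₂ w →
      Eval (.split k M N) (n₁ + n₂) (scale k r₁ + r₂) w
  | inl {M v : ATm 0} {n : ℕ} {r : ZInf} : Eval M n r v → Eval (.inl M) n r (.inl v)
  | inr {M v : ATm 0} {n : ℕ} {r : ZInf} : Eval M n r v → Eval (.inr M) n r (.inr v)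
  | case_inl {k : Mult} {M v w : ATm 0} {N₁ N₂ : ATm 1} {n₁ n₂ : ℕ} {r₁ r₂ : ZInf} :
      Eval M n₁ r₁ (.inl v) → Eval (N₁.inst v) n₂ r₂ w →
      Eval (.case k M N₁ N₂) (n₁ + n₂) (scale k r₁ + r₂) w
  | case_inr {k : Mult} {M v w : ATm 0} {N₁ N₂ : ATm 1} {n₁ n₂ : ℕ} {r₁ r₂ : ZInf} :
      Eval M n₁ r₁ (.inr v) → Eval (N₂.inst v) n₂ r₂ w →
      Eval (.case k M N₁ N₂) (n₁ + n₂) (scale k r₁ + r₂) w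
  | ampPair {M N : ATm 0} : Eval (.ampPair M N) 0 0 (.ampPair M N)
  | fst {M M₁ M₂ v : ATm 0} {n₁ n₂ : ℕ} {r₁ r₂ : ZInf} :
      Eval M n₁ r₁ (.ampPair M₁ M₂) → Eval M₁ n₂ r₂ v →
      Eval (.fst M) (n₁ + n₂) (r₁ + r₂) v
  | snd {M M₁ M₂ v : ATm 0} {n₁ n₂ : ℕ} {r₁ r₂ : ZInf} :
      Eval M n₁ r₁ (.ampPair M₁ M₂) → Eval M₂ n₂ r₂ v →
      Eval (.snd M) (n₁ + n₂) (r₁ + r₂) v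
  | lam {M : ATm 1} : Eval (.lam M) 0 0 (.lam M)
  | app {M N v w : ATm 0} {M' : ATm 1} {n₁ n₂ n₃ : ℕ} {r₁ r₂ r₃ : ZInf} :
      Eval M n₁ r₁ (.lam M') → Eval N n₂ r₂ v → Eval (M'.inst v) n₃ r₃ w →
      Eval (.app M N) (n₁ + n₂ + n₃) (r₁ + r₂ + r₃) w
  | save {k : Mult} {l : ℕ∞} {M v : ATm 0} {n : ℕ} {r : ZInf} :
      Eval M n r v → Eval (.save k l M) n (scale k r) (.save k l v)
  | transfer {k' k : Mult} {l : ℕ∞} {M v w : ATm 0} {N : ATm 1} {n₁ n₂ : ℕ} {r₁ r₂ : ZInf} :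
      Eval M n₁ r₁ (.save k l v) → Eval (N.inst v) n₂ r₂ w →
      Eval (.transfer k' k l M N) (n₁ + n₂) (scale k' r₁ + r₂) w
  | tick {M v : ATm 0} {n : ℕ} {r : ZInf} : Eval M n r v → Eval (.tick M) (n + 1) r v
  | create {l : ℕ∞} {M v : ATm 0} {n : ℕ} {r : ZInf} :
      Eval M n r v → Eval (.create l M) n (r + credit l) v
  | spend {l : ℕ∞} {M v : ATm 0} {n : ℕ} {r : ZInf} :
      Eval M n r v → Eval (.spend l M) n (r + negCredit l) v
  | zero : Eval .zero 0 0 .zero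
  | succ {M v : ATm 0} {n : ℕ} {r : ZInf} : Eval M n r v → Eval (.succ M) n r (.succ v)
  | nrec_zero {M N₁ N₂ w : ATm 0} {N₁' N₂' : ATm 1} {n₁ n₂ n₃ n₄ : ℕ} {r₁ r₂ r₃ r₄ : ZInf} :
      Eval M n₁ r₁ .zero →
      Eval N₁ n₂ r₂ (.lam N₁') →
      Eval N₂ n₃ r₃ (.save Mult.inf 0 (.lam N₂')) →
      Eval (N₁'.inst .unit) n₄ r₄ w →
      Eval (.nrec M N₁ N₂) (n₁ + n₂ + n₃ + n₄) (r₁ + r₂ + r₃ + r₄) w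
  | nrec_succ {M N₁ N₂ v w : ATm 0} {N₁' N₂' : ATm 1} {n₁ n₂ n₃ n₄ : ℕ}
      {r₁ r₂ r₃ r₄ : ZInf} :
      Eval M n₁ r₁ (.succ v) →
      Eval N₁ n₂ r₂ (.lam N₁') →
      Eval N₂ n₃ r₃ (.save Mult.inf 0 (.lam N₂')) →
      Eval (N₂'.inst (.pair v
        (.lam (ATm.weaken (.nrec v (.lam N₁') (.save Mult.inf 0 (.lam N₂'))))))) n₄ r₄ w →
      Eval (.nrec M N₁ N₂) (n₁ + n₂ + n₃ + n₄) (r₁ + r₂ + r₃ + r₄) w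
  | nil : Eval .nil 0 0 .nil
  | cons {M N v w : ATm 0} {n₁ n₂ : ℕ} {r₁ r₂ : ZInf} :
      Eval M n₁ r₁ v → Eval N n₂ r₂ w →
      Eval (.cons M N) (n₁ + n₂) (r₁ + r₂) (.cons v w)
  | lrec_nil {M N₁ N₂ w : ATm 0} {N₁' N₂' : ATm 1} {n₁ n₂ n₃ n₄ : ℕ} {r₁ r₂ r₃ r₄ : ZInf} :
      Eval M n₁ r₁ .nil →
      Eval N₁ n₂ r₂ (.lam N₁') →
      Eval N₂ n₃ r₃ (.save Mult.inf 0 (.lam N₂')) →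
      Eval (N₁'.inst .unit) n₄ r₄ w →
      Eval (.lrec M N₁ N₂) (n₁ + n₂ + n₃ + n₄) (r₁ + r₂ + r₃ + r₄) w
  | lrec_cons {M N₁ N₂ v₁ v₂ w : ATm 0} {N₁' N₂' : ATm 1} {n₁ n₂ n₃ n₄ : ℕ}
      {r₁ r₂ r₃ r₄ : ZInf} :
      Eval M n₁ r₁ (.cons v₁ v₂) →
      Eval N₁ n₂ r₂ (.lam N₁') →
      Eval N₂ n₃ r₃ (.save Mult.inf 0 (.lam N₂')) →
      Eval (N₂'.inst (.pair v₁
        (.ampPair v₂ (.lrec v₂ (.lam N₁') (.save Mult.inf 0 (.lam N₂')))))) n₄ r₄ w →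
      Eval (.lrec M N₁ N₂) (n₁ + n₂ + n₃ + n₄) (r₁ + r₂ + r₃ + r₄) w

/-! ### The recurrence language -/

/-- Types of `λ^ℂ`. -/
inductive CTy : Type
  | cost : CTy
  | one : CTy
  | prod : CTy → CTy → CTy
  | sum : CTy → CTy → CTy
  | arr : CTy → CTy → CTy
  | nat : CTy
  | list : CTy → CTy

/-- Terms of `λ^ℂ`. -/
inductive CTm : ℕ → Type
  | var {n : ℕ} (i : Fin n) : CTm n
  /-- Cost constants. -/
  | const {n : ℕ} (c : ZInf) : CTm n
  /-- Addition of costs. -/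
  | add {n : ℕ} (E E' : CTm n) : CTm n
  /-- The multiple `k · E` of a cost. -/
  | smul {n : ℕ} (k : Mult) (E : CTm n) : CTm n
  | unit {n : ℕ} : CTm n
  | pair {n : ℕ} (E E' : CTm n) : CTm n
  | fst {n : ℕ} (E : CTm n) : CTm n
  | snd {n : ℕ} (E : CTm n) : CTm n
  | inl {n : ℕ} (E : CTm n) : CTm n
  | inr {n : ℕ} (E : CTm n) : CTm n
  | case {n : ℕ} (E : CTm n) (E₁ E₂ : CTm (n + 1)) : CTm n
  | lam {n : ℕ} (E : CTm (n + 1)) : CTm n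
  | app {n : ℕ} (E E' : CTm n) : CTm n
  | zero {n : ℕ} : CTm n
  | succ {n : ℕ} (E : CTm n) : CTm n
  | nrec {n : ℕ} (E E₁ E₂ : CTm n) : CTm n
  | nil {n : ℕ} : CTm n
  | cons {n : ℕ} (E E' : CTm n) : CTm n
  | lrec {n : ℕ} (E E₁ E₂ : CTm n) : CTm n

def CTm.rename : {n m : ℕ} → (Fin n → Fin m) → CTm n → CTm m
  | _, _, ρ, .var i => .var (ρ i)
  | _, _, _, .const c => .const c
  | _, _, ρ, .add E E' => .add (E.rename ρ) (E'.rename ρ)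
  | _, _, ρ, .smul k E => .smul k (E.rename ρ)
  | _, _, _, .unit => .unit
  | _, _, ρ, .pair E E' => .pair (E.rename ρ) (E'.rename ρ)
  | _, _, ρ, .fst E => .fst (E.rename ρ)
  | _, _, ρ, .snd E => .snd (E.rename ρ)
  | _, _, ρ, .inl E => .inl (E.rename ρ)
  | _, _, ρ, .inr E => .inr (E.rename ρ)
  | _, _, ρ, .case E E₁ E₂ =>
      .case (E.rename ρ) (E₁.rename (liftRen ρ)) (E₂.rename (liftRen ρ))
  | _, _, ρ, .lam E => .lam (E.rename (liftRen ρ))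
  | _, _, ρ, .app E E' => .app (E.rename ρ) (E'.rename ρ)
  | _, _, _, .zero => .zero
  | _, _, ρ, .succ E => .succ (E.rename ρ)
  | _, _, ρ, .nrec E E₁ E₂ => .nrec (E.rename ρ) (E₁.rename ρ) (E₂.rename ρ)
  | _, _, _, .nil => .nil
  | _, _, ρ, .cons E E' => .cons (E.rename ρ) (E'.rename ρ)
  | _, _, ρ, .lrec E E₁ E₂ => .lrec (E.rename ρ) (E₁.rename ρ) (E₂.rename ρ)

def CTm.weaken {n : ℕ} (E : CTm n) : CTm (n + 1) := E.rename Fin.succ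

def CTm.lift {n m : ℕ} (Θ : Fin n → CTm m) : Fin (n + 1) → CTm (m + 1) :=
  Fin.cons (.var 0) (fun i => (Θ i).weaken)

/-- Simultaneous capture-avoiding substitution `E[Θ]`. -/
def CTm.subst : {n m : ℕ} → (Fin n → CTm m) → CTm n → CTm m
  | _, _, Θ, .var i => Θ i
  | _, _, _, .const c => .const c
  | _, _, Θ, .add E E' => .add (E.subst Θ) (E'.subst Θ)
  | _, _, Θ, .smul k E => .smul k (E.subst Θ)
  | _, _, _, .unit => .unit
  | _, _, Θ, .pair E E' => .pair (E.subst Θ) (E'.subst Θ)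
  | _, _, Θ, .fst E => .fst (E.subst Θ)
  | _, _, Θ, .snd E => .snd (E.subst Θ)
  | _, _, Θ, .inl E => .inl (E.subst Θ)
  | _, _, Θ, .inr E => .inr (E.subst Θ)
  | _, _, Θ, .case E E₁ E₂ =>
      .case (E.subst Θ) (E₁.subst (CTm.lift Θ)) (E₂.subst (CTm.lift Θ))
  | _, _, Θ, .lam E => .lam (E.subst (CTm.lift Θ))
  | _, _, Θ, .app E E' => .app (E.subst Θ) (E'.subst Θ)
  | _, _, _, .zero => .zero
  | _, _, Θ, .succ E => .succ (E.subst Θ)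
  | _, _, Θ, .nrec E E₁ E₂ => .nrec (E.subst Θ) (E₁.subst Θ) (E₂.subst Θ)
  | _, _, _, .nil => .nil
  | _, _, Θ, .cons E E' => .cons (E.subst Θ) (E'.subst Θ)
  | _, _, Θ, .lrec E E₁ E₂ => .lrec (E.subst Θ) (E₁.subst Θ) (E₂.subst Θ)

/-- `E[E'/x]` for the most recently bound variable `x`. -/
def CTm.inst {n : ℕ} (E : CTm (n + 1)) (E' : CTm n) : CTm n :=
  E.subst (Fin.cons E' CTm.var)

/-- `E[E₁/x, E₂/y]`, where `x` is variable `1` and `y` is variable `0`. -/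
def CTm.inst₂ {n : ℕ} (E : CTm (n + 2)) (E₁ E₂ : CTm n) : CTm n :=
  E.subst (Fin.cons E₂ (Fin.cons E₁ CTm.var))

/-- Contexts of `λ^ℂ` with `n` variables. -/
abbrev CCtx (n : ℕ) : Type := Fin n → CTy

def CCtx.ext {n : ℕ} (Γ : CCtx n) (T : CTy) : CCtx (n + 1) := Fin.cons T Γ

/-- The empty context. -/
def CCtx.nil : CCtx 0 := Fin.elim0

/-- The (structural) typing judgment `Γ ⊢ E : T` of `λ^ℂ`. -/
inductive CHasTy : {n : ℕ} → CCtx n → CTm n → CTy → Prop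
  | var {n : ℕ} {Γ : CCtx n} (i : Fin n) : CHasTy Γ (.var i) (Γ i)
  | const {n : ℕ} {Γ : CCtx n} (c : ZInf) : CHasTy Γ (.const c) .cost
  | add {n : ℕ} {Γ : CCtx n} {E E' : CTm n} :
      CHasTy Γ E .cost → CHasTy Γ E' .cost → CHasTy Γ (.add E E') .cost
  | smul {n : ℕ} {Γ : CCtx n} {k : Mult} {E : CTm n} :
      CHasTy Γ E .cost → CHasTy Γ (.smul k E) .cost
  | unit {n : ℕ} {Γ : CCtx n} : CHasTy Γ .unit .one
  | pair {n : ℕ} {Γ : CCtx n} {E E' : CTm n} {T T' : CTy} :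
      CHasTy Γ E T → CHasTy Γ E' T' → CHasTy Γ (.pair E E') (.prod T T')
  | fst {n : ℕ} {Γ : CCtx n} {E : CTm n} {T T' : CTy} :
      CHasTy Γ E (.prod T T') → CHasTy Γ (.fst E) T
  | snd {n : ℕ} {Γ : CCtx n} {E : CTm n} {T T' : CTy} :
      CHasTy Γ E (.prod T T') → CHasTy Γ (.snd E) T'
  | inl {n : ℕ} {Γ : CCtx n} {E : CTm n} {T T' : CTy} :
      CHasTy Γ E T → CHasTy Γ (.inl E) (.sum T T')
  | inr {n : ℕ} {Γ : CCtx n} {E : CTm n} {T T' : CTy} :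
      CHasTy Γ E T' → CHasTy Γ (.inr E) (.sum T T')
  | case {n : ℕ} {Γ : CCtx n} {E : CTm n} {E₁ E₂ : CTm (n + 1)} {T₁ T₂ T : CTy} :
      CHasTy Γ E (.sum T₁ T₂) → CHasTy (Γ.ext T₁) E₁ T → CHasTy (Γ.ext T₂) E₂ T →
      CHasTy Γ (.case E E₁ E₂) T
  | lam {n : ℕ} {Γ : CCtx n} {E : CTm (n + 1)} {T T' : CTy} :
      CHasTy (Γ.ext T) E T' → CHasTy Γ (.lam E) (.arr T T')
  | app {n : ℕ} {Γ : CCtx n} {E E' : CTm n} {T T' : CTy} :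
      CHasTy Γ E (.arr T T') → CHasTy Γ E' T → CHasTy Γ (.app E E') T'
  | zero {n : ℕ} {Γ : CCtx n} : CHasTy Γ .zero .nat
  | succ {n : ℕ} {Γ : CCtx n} {E : CTm n} : CHasTy Γ E .nat → CHasTy Γ (.succ E) .nat
  | nrec {n : ℕ} {Γ : CCtx n} {E E₁ E₂ : CTm n} {T : CTy} :
      CHasTy Γ E .nat → CHasTy Γ E₁ (.arr .one T) →
      CHasTy Γ E₂ (.arr (.prod .nat T) T) → CHasTy Γ (.nrec E E₁ E₂) T
  | nil {n : ℕ} {Γ : CCtx n} {T : CTy} : CHasTy Γ .nil (.list T)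
  | cons {n : ℕ} {Γ : CCtx n} {E E' : CTm n} {T : CTy} :
      CHasTy Γ E T → CHasTy Γ E' (.list T) → CHasTy Γ (.cons E E') (.list T)
  | lrec {n : ℕ} {Γ : CCtx n} {E E₁ E₂ : CTm n} {T' T : CTy} :
      CHasTy Γ E (.list T') → CHasTy Γ E₁ (.arr .one T) →
      CHasTy Γ E₂ (.arr (.prod T' (.prod (.list T') T)) T) → CHasTy Γ (.lrec E E₁ E₂) T

/-- The syntactic inequality judgment `Γ ⊢ E ≤_T E'` on well-typed terms: a preorder, with
congruence in the principal positions of elimination forms, `β`-reducts below their redexes,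
and the arithmetic of costs. -/
inductive CLe : {n : ℕ} → CCtx n → CTy → CTm n → CTm n → Prop
  | refl {n : ℕ} {Γ : CCtx n} {T : CTy} {E : CTm n} : CHasTy Γ E T → CLe Γ T E E
  | trans {n : ℕ} {Γ : CCtx n} {T : CTy} {E E' E'' : CTm n} :
      CLe Γ T E E' → CLe Γ T E' E'' → CLe Γ T E E''
  -- congruence in principal positions
  | fst_congr {n : ℕ} {Γ : CCtx n} {T T' : CTy} {E E' : CTm n} :
      CLe Γ (.prod T T') E E' → CLe Γ T (.fst E) (.fst E')
  | snd_congr {n : ℕ} {Γ : CCtx n} {T T' : CTy} {E E' : CTm n} :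
      CLe Γ (.prod T T') E E' → CLe Γ T' (.snd E) (.snd E')
  | case_congr {n : ℕ} {Γ : CCtx n} {T₁ T₂ T : CTy} {E E' : CTm n} {E₁ E₂ : CTm (n + 1)} :
      CLe Γ (.sum T₁ T₂) E E' → CHasTy (Γ.ext T₁) E₁ T → CHasTy (Γ.ext T₂) E₂ T →
      CLe Γ T (.case E E₁ E₂) (.case E' E₁ E₂)
  | app_congr {n : ℕ} {Γ : CCtx n} {T T' : CTy} {E E' E₁ : CTm n} :
      CLe Γ (.arr T T') E E' → CHasTy Γ E₁ T → CLe Γ T' (.app E E₁) (.app E' E₁)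
  | nrec_congr {n : ℕ} {Γ : CCtx n} {T : CTy} {E E' E₁ E₂ : CTm n} :
      CLe Γ .nat E E' → CHasTy Γ E₁ (.arr .one T) → CHasTy Γ E₂ (.arr (.prod .nat T) T) →
      CLe Γ T (.nrec E E₁ E₂) (.nrec E' E₁ E₂)
  | lrec_congr {n : ℕ} {Γ : CCtx n} {T' T : CTy} {E E' E₁ E₂ : CTm n} :
      CLe Γ (.list T') E E' → CHasTy Γ E₁ (.arr .one T) →
      CHasTy Γ E₂ (.arr (.prod T' (.prod (.list T') T)) T) →
      CLe Γ T (.lrec E E₁ E₂) (.lrec E' E₁ E₂)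
  -- reducts are below redexes
  | fst_beta {n : ℕ} {Γ : CCtx n} {T T' : CTy} {E E' : CTm n} :
      CHasTy Γ E T → CHasTy Γ E' T' → CLe Γ T E (.fst (.pair E E'))
  | snd_beta {n : ℕ} {Γ : CCtx n} {T T' : CTy} {E E' : CTm n} :
      CHasTy Γ E T → CHasTy Γ E' T' → CLe Γ T' E' (.snd (.pair E E'))
  | inl_beta {n : ℕ} {Γ : CCtx n} {T₁ T₂ T : CTy} {E : CTm n} {E₁ E₂ : CTm (n + 1)} :
      CHasTy Γ E T₁ → CHasTy (Γ.ext T₁) E₁ T → CHasTy (Γ.ext T₂) E₂ T →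
      CLe Γ T (E₁.inst E) (.case (.inl E) E₁ E₂)
  | inr_beta {n : ℕ} {Γ : CCtx n} {T₁ T₂ T : CTy} {E : CTm n} {E₁ E₂ : CTm (n + 1)} :
      CHasTy Γ E T₂ → CHasTy (Γ.ext T₁) E₁ T → CHasTy (Γ.ext T₂) E₂ T →
      CLe Γ T (E₂.inst E) (.case (.inr E) E₁ E₂)
  | lam_beta {n : ℕ} {Γ : CCtx n} {T T' : CTy} {E : CTm (n + 1)} {E' : CTm n} :
      CHasTy (Γ.ext T) E T' → CHasTy Γ E' T → CLe Γ T' (E.inst E') (.app (.lam E) E')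
  | zero_beta {n : ℕ} {Γ : CCtx n} {T : CTy} {E₁ E₂ : CTm n} :
      CHasTy Γ E₁ (.arr .one T) → CHasTy Γ E₂ (.arr (.prod .nat T) T) →
      CLe Γ T (.app E₁ .unit) (.nrec .zero E₁ E₂)
  | succ_beta {n : ℕ} {Γ : CCtx n} {T : CTy} {E E₁ E₂ : CTm n} :
      CHasTy Γ E .nat → CHasTy Γ E₁ (.arr .one T) → CHasTy Γ E₂ (.arr (.prod .nat T) T) →
      CLe Γ T (.app E₂ (.pair E (.nrec E E₁ E₂))) (.nrec (.succ E) E₁ E₂)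
  | nil_beta {n : ℕ} {Γ : CCtx n} {T' T : CTy} {E₁ E₂ : CTm n} :
      CHasTy Γ E₁ (.arr .one T) →
      CHasTy Γ E₂ (.arr (.prod T' (.prod (.list T') T)) T) →
      CLe Γ T (.app E₁ .unit) (.lrec .nil E₁ E₂)
  | cons_beta {n : ℕ} {Γ : CCtx n} {T' T : CTy} {E E' E₁ E₂ : CTm n} :
      CHasTy Γ E T' → CHasTy Γ E' (.list T') → CHasTy Γ E₁ (.arr .one T) →
      CHasTy Γ E₂ (.arr (.prod T' (.prod (.list T') T)) T) →
      CLe Γ T (.app E₂ (.pair E (.pair E' (.lrec E' E₁ E₂)))) (.lrec (.cons E E') E₁ E₂)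
  -- costs: ordered commutative monoid, multiples, and arithmetic of constants
  | add_congr {n : ℕ} {Γ : CCtx n} {E₁ E₁' E₂ E₂' : CTm n} :
      CLe Γ .cost E₁ E₁' → CLe Γ .cost E₂ E₂' → CLe Γ .cost (.add E₁ E₂) (.add E₁' E₂')
  | smul_congr {n : ℕ} {Γ : CCtx n} {k : Mult} {E E' : CTm n} :
      CLe Γ .cost E E' → CLe Γ .cost (.smul k E) (.smul k E')
  | add_comm {n : ℕ} {Γ : CCtx n} {E E' : CTm n} :
      CHasTy Γ E .cost → CHasTy Γ E' .cost → CLe Γ .cost (.add E E') (.add E' E)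
  | add_assoc {n : ℕ} {Γ : CCtx n} {E₁ E₂ E₃ : CTm n} :
      CHasTy Γ E₁ .cost → CHasTy Γ E₂ .cost → CHasTy Γ E₃ .cost →
      CLe Γ .cost (.add (.add E₁ E₂) E₃) (.add E₁ (.add E₂ E₃))
  | add_assoc' {n : ℕ} {Γ : CCtx n} {E₁ E₂ E₃ : CTm n} :
      CHasTy Γ E₁ .cost → CHasTy Γ E₂ .cost → CHasTy Γ E₃ .cost →
      CLe Γ .cost (.add E₁ (.add E₂ E₃)) (.add (.add E₁ E₂) E₃)
  | zero_add {n : ℕ} {Γ : CCtx n} {E : CTm n} :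
      CHasTy Γ E .cost → CLe Γ .cost (.add (.const 0) E) E
  | zero_add' {n : ℕ} {Γ : CCtx n} {E : CTm n} :
      CHasTy Γ E .cost → CLe Γ .cost E (.add (.const 0) E)
  | const {n : ℕ} {Γ : CCtx n} {c c' : ZInf} :
      c ≤ c' → CLe Γ .cost (.const c) (.const c')
  | const_add {n : ℕ} {Γ : CCtx n} (c c' : ZInf) :
      CLe Γ .cost (.const (c + c')) (.add (.const c) (.const c'))
  | const_add' {n : ℕ} {Γ : CCtx n} (c c' : ZInf) :
      CLe Γ .cost (.add (.const c) (.const c')) (.const (c + c'))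
  | const_smul {n : ℕ} {Γ : CCtx n} (k : Mult) (c : ZInf) :
      CLe Γ .cost (.const (scale k c)) (.smul k (.const c))
  | const_smul' {n : ℕ} {Γ : CCtx n} (k : Mult) (c : ZInf) :
      CLe Γ .cost (.smul k (.const c)) (.const (scale k c))

/-! ### Recurrence extraction -/

/-- The potential type `⟨⟨A⟩⟩`. -/
def pot : Ty → CTy
  | .one => .one
  | .tensor A B => .prod (pot A) (pot B)
  | .plus A B => .sum (pot A) (pot B)
  | .amp A B => .prod (.prod .cost (pot A)) (.prod .cost (pot B))
  | .lolli A B => .arr (pot A) (.prod .cost (pot B))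
  | .bang _ _ A => pot A
  | .nat => .nat
  | .list A => .list (pot A)

/-- The complexity type `‖A‖ = ℂ × ⟨⟨A⟩⟩`. -/
def cpx (A : Ty) : CTy := .prod .cost (pot A)

/-- `E +_c E' = (E + E'_c, E'_p)`. -/
def CTm.addc {n : ℕ} (E E' : CTm n) : CTm n := .pair (.add E (.fst E')) (.snd E')

/-- The extracted recurrence `‖M‖`. -/
def extract : {n : ℕ} → ATm n → CTm n
  | _, .var i => .pair (.const 0) (.var i)
  | _, .unit => .pair (.const 0) .unit
  | _, .pair M N =>
      .pair (.add (.fst (extract M)) (.fst (extract N)))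
        (.pair (.snd (extract M)) (.snd (extract N)))
  | _, .split k M N =>
      CTm.addc (.smul k (.fst (extract M)))
        ((extract N).inst₂ (.fst (.snd (extract M))) (.snd (.snd (extract M))))
  | _, .inl M => .pair (.fst (extract M)) (.inl (.snd (extract M)))
  | _, .inr M => .pair (.fst (extract M)) (.inr (.snd (extract M)))
  | _, .case k M N₁ N₂ =>
      CTm.addc (.smul k (.fst (extract M)))
        (.case (.snd (extract M)) (extract N₁) (extract N₂))
  | _, .ampPair M N => .pair (.const 0) (.pair (extract M) (extract N))
  | _, .fst M => CTm.addc (.fst (extract M)) (.fst (.snd (extract M)))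
  | _, .snd M => CTm.addc (.fst (extract M)) (.snd (.snd (extract M)))
  | _, .lam M => .pair (.const 0) (.lam (extract M))
  | _, .app M N =>
      CTm.addc (.add (.fst (extract M)) (.fst (extract N)))
        (.app (.snd (extract M)) (.snd (extract N)))
  | _, .save k _ M => .pair (.smul k (.fst (extract M))) (.snd (extract M))
  | _, .transfer k' _ _ M N =>
      CTm.addc (.smul k' (.fst (extract M))) ((extract N).inst (.snd (extract M)))
  | _, .tick M => CTm.addc (.const 1) (extract M)
  | _, .create l M => CTm.addc (.const (credit l)) (extract M)
  | _, .spend l M => CTm.addc (.const (negCredit l)) (extract M)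
  | _, .zero => .pair (.const 0) .zero
  | _, .succ M => .pair (.fst (extract M)) (.succ (.snd (extract M)))
  | _, .nrec M N₁ N₂ =>
      -- the step function is `λ p. ‖N₂‖_p (π₁ p, λ z. π₂ p)`
      CTm.addc (.add (.add (.fst (extract M)) (.fst (extract N₁))) (.fst (extract N₂)))
        (.nrec (.snd (extract M)) (.snd (extract N₁))
          (.lam (.app (CTm.weaken (.snd (extract N₂)))
            (.pair (.fst (.var 0)) (.lam (.snd (.var 1)))))))
  | _, .nil => .pair (.const 0) .nil
  | _, .cons M N =>
      .pair (.add (.fst (extract M)) (.fst (extract N)))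
        (.cons (.snd (extract M)) (.snd (extract N)))
  | _, .lrec M N₁ N₂ =>
      -- the step function is `λ p. ‖N₂‖_p (π₁ p, ((0, π₁ π₂ p), π₂ π₂ p))`
      CTm.addc (.add (.add (.fst (extract M)) (.fst (extract N₁))) (.fst (extract N₂)))
        (.lrec (.snd (extract M)) (.snd (extract N₁))
          (.lam (.app (CTm.weaken (.snd (extract N₂)))
            (.pair (.fst (.var 0))
              (.pair (.pair (.const 0) (.fst (.snd (.var 0)))) (.snd (.snd (.var 0))))))))

/-! ### The bounding relation -/

/-- `· ⊢_a M : A` for a closed term, whose resource term is just a number `a`. -/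
def ClosedTy (a : ℕ∞) (M : ATm 0) (A : Ty) : Prop := HasTy Fin.elim0 (Res.bank a) M A

/-- The clauses of the term bounding relation `M ⊑^{A,a} E`, given the value bounding relation
`V` at the type `A`.  The typing judgments presupposed by the relation are part of it, and the
number `a + r` of remaining credits is required to be an element `a'` of `ℕ ∪ {∞}`. -/
def TermClause (A : Ty) (V : ℕ∞ → ATm 0 → CTm 0 → Prop) (a : ℕ∞) (M : ATm 0) (E : CTm 0) :
    Prop :=
  ClosedTy a M A ∧ CHasTy CCtx.nil E (cpx A) ∧
    ∀ (n : ℕ) (r : ZInf) (v : ATm 0), Eval M n r v →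
      CLe CCtx.nil .cost (.const ((n : ZInf) + r)) (.fst E) ∧
      ∃ a' : ℕ∞, credit a' = credit a + r ∧ V a' v (.snd E)

/-- The value bounding relation at `ℕ`, by induction on the value. -/
inductive NatClause : ATm 0 → CTm 0 → Prop
  | zero {E : CTm 0} : CLe CCtx.nil .nat .zero E → NatClause .zero E
  | succ {v : ATm 0} {E E' : CTm 0} :
      CLe CCtx.nil .nat (.succ E') E → NatClause v E' → NatClause (.succ v) E

/-- The value bounding relation at `list A`, by induction on the value, given the value bounding
relation `V` at `A`. -/
inductive ListClause (A : Ty) (V : ℕ∞ → ATm 0 → CTm 0 → Prop) : ℕ∞ → ATm 0 → CTm 0 → Prop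
  | nil {a : ℕ∞} {E : CTm 0} :
      CLe CCtx.nil (.list (pot A)) .nil E → ListClause A V a .nil E
  | cons {a₁ a₂ : ℕ∞} {v₁ v₂ : ATm 0} {E E₁ E₂ : CTm 0} :
      CLe CCtx.nil (.list (pot A)) (.cons E₁ E₂) E →
      V a₁ v₁ E₁ → ListClause A V a₂ v₂ E₂ → ListClause A V (a₁ + a₂) (.cons v₁ v₂) E

/-- The value bounding relation `v ⊑_val^{A,a} E`, by recursion on `A`.  The presupposed typing
judgments `· ⊢_a v : A` and `· ⊢ E : ⟨⟨A⟩⟩` are part of the relation. -/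
def ValRel : Ty → ℕ∞ → ATm 0 → CTm 0 → Prop
  | .one, a, v, E =>
      ClosedTy a v .one ∧ CHasTy CCtx.nil E (pot .one) ∧
      v = .unit ∧ CLe CCtx.nil .one .unit E
  | .tensor A B, a, v, E =>
      ClosedTy a v (.tensor A B) ∧ CHasTy CCtx.nil E (pot (.tensor A B)) ∧
      ∃ v₁ v₂, v = .pair v₁ v₂ ∧ ∃ a₁ a₂, a₁ + a₂ = a ∧
        ValRel A a₁ v₁ (.fst E) ∧ ValRel B a₂ v₂ (.snd E)
  | .plus A B, a, v, E =>
      ClosedTy a v (.plus A B) ∧ CHasTy CCtx.nil E (pot (.plus A B)) ∧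
      ((∃ w E', v = .inl w ∧ CLe CCtx.nil (pot (.plus A B)) (.inl E') E ∧ ValRel A a w E') ∨
       (∃ w E', v = .inr w ∧ CLe CCtx.nil (pot (.plus A B)) (.inr E') E ∧ ValRel B a w E'))
  | .amp A B, a, v, E =>
      ClosedTy a v (.amp A B) ∧ CHasTy CCtx.nil E (pot (.amp A B)) ∧
      ∃ M N, v = .ampPair M N ∧
        TermClause A (ValRel A) a M (.fst E) ∧ TermClause B (ValRel B) a N (.snd E)
  | .lolli A B, a, v, E =>
      ClosedTy a v (.lolli A B) ∧ CHasTy CCtx.nil E (pot (.lolli A B)) ∧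
      ∃ M, v = .lam M ∧ ∀ (w : ATm 0) (d : ℕ∞) (E' : CTm 0), ValRel A d w E' →
        TermClause B (ValRel B) (a + d) (M.inst w) (.app E E')
  | .bang k l A, a, v, E =>
      ClosedTy a v (.bang k l A) ∧ CHasTy CCtx.nil E (pot (.bang k l A)) ∧
      ∃ w, v = .save k l w ∧ ∃ d : ℕ∞, k.1 * d + l ≤ a ∧ ValRel A d w E
  | .nat, a, v, E =>
      ClosedTy a v .nat ∧ CHasTy CCtx.nil E (pot .nat) ∧ NatClause v E
  | .list A, a, v, E =>
      ClosedTy a v (.list A) ∧ CHasTy CCtx.nil E (pot (.list A)) ∧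
      ListClause A (ValRel A) a v E

/-- The term bounding relation `M ⊑^{A,a} E` on closed terms. -/
def TermRel (A : Ty) (a : ℕ∞) (M : ATm 0) (E : CTm 0) : Prop :=
  TermClause A (ValRel A) a M E

/-- The bounding relation `θ ⊑_sub^{Γ,σ} Θ` on closing substitutions. -/
def SubRel {n : ℕ} (Γ : Ctx n) (σ : Fin n → ℕ∞) (θ : Fin n → ATm 0) (Θ : Fin n → CTm 0) :
    Prop :=
  ∀ i, ValRel (Γ i) (σ i) (θ i) (Θ i)

/-- The bounding relation `M ⊑ E` for open terms `Γ ⊢_f M : A`. -/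
def OpenRel {n : ℕ} (Γ : Ctx n) (f : Res n) (M : ATm n) (A : Ty) (E : CTm n) : Prop :=
  ∀ (σ : Fin n → ℕ∞) (θ : Fin n → ATm 0) (Θ : Fin n → CTm 0),
    SubRel Γ σ θ Θ → TermRel A (f.eval σ) (M.subst θ) (E.subst Θ)

end

end AmortRec

/-!
Every extracted recurrence bounds its term, because the bounding relation is a logical relation
that each typing rule preserves.  The proof is an induction on the typing derivation
(`HasTy.openRel`).  The typing judgments that the relation contains come from substitution lemmas
for both languages (`HasTy.subst`, `CHasTy.subst`) and from the fact that `‖M‖` has type `‖A‖`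
(`CHasTy.extract`), so each case reduces to a statement about one evaluation.

Three facts carry these cases.

* The relation is monotone in the credits and in the bound (`ValRel.mono`, `TermRel.mono`).  Since
  reducts lie below redexes, a bound of a reduct is one of the extracted redex.
* An elimination form evaluates its scrutinee and then a body.  If the body needs no more credits
  than the first phase leaves, bounds of the two phases add up (`Outcome.addc`).  When the
  scrutinee is used `k` times, starts with `a` credits and creates `r` more, leaving `a'`, the
  body may use `k a'` credits, while `k a + k r` are counted.  For `k = ∞` multiplication does not
  distribute over `a + r`, because `∞` absorbs `-∞`; the inequality `k a' ≤ k a + k r` still holds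
  (`credit_mul_le`), and monotonicity absorbs the difference.  The analogous inequality for costs
  is `natCast_add_scale_le`.
* The recursors are handled by an inner induction on the value recursed over
  (`NatClause.nrecBody_rel`, `ListClause.lrecBody_rel`).  The step function is saved with
  multiplicity `∞`, so the `d` credits it needs satisfy `∞ · d ≤ h` for the `h` credits available,
  whence `d + h ≤ h`: the same `h` credits pay for a step and for all later ones.
-/

namespace AmortRec

noncomputable section

/-! ### Substitution calculus of the two syntaxes -/

@[simp] theorem liftRen_zero {n m : ℕ} (ρ : Fin n → Fin m) : liftRen ρ 0 = 0 := rfl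

@[simp] theorem liftRen_succ {n m : ℕ} (ρ : Fin n → Fin m) (i : Fin n) :
    liftRen ρ i.succ = (ρ i).succ := rfl

namespace ATm

@[simp] theorem lift_zero {n m : ℕ} (θ : Fin n → ATm m) : lift θ 0 = .var 0 := rfl

@[simp] theorem lift_succ {n m : ℕ} (θ : Fin n → ATm m) (i : Fin n) :
    lift θ i.succ = (θ i).weaken := rfl

theorem lift_comp_liftRen {n m l : ℕ} (ρ : Fin n → Fin m) (θ : Fin m → ATm l) :
    lift (fun i => θ (ρ i)) = fun i => lift θ (liftRen ρ i) := by
  funext i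
  cases i using Fin.cases <;> simp

theorem lift_var {n : ℕ} : lift (var : Fin n → ATm n) = var := by
  funext i
  cases i using Fin.cases <;> simp [weaken, rename]

theorem lift_var_comp {n m : ℕ} (ρ : Fin n → Fin m) :
    lift (fun i => .var (ρ i)) = fun i => .var (liftRen ρ i) := by
  funext i
  cases i using Fin.cases <;> simp [weaken, rename]

theorem subst_var {n : ℕ} (M : ATm n) : M.subst var = M := by
  induction M <;> simp [subst, lift_var, *]

theorem rename_eq_subst {n m : ℕ} (ρ : Fin n → Fin m) (M : ATm n) :
    M.rename ρ = M.subst (fun i => .var (ρ i)) := by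
  induction M generalizing m <;> simp [subst, rename, lift_var_comp, *]

theorem subst_rename {n m l : ℕ} (ρ : Fin n → Fin m) (θ : Fin m → ATm l) (M : ATm n) :
    (M.rename ρ).subst θ = M.subst (fun i => θ (ρ i)) := by
  induction M generalizing m l <;> simp [subst, rename, lift_comp_liftRen, *]

theorem rename_weaken {n m : ℕ} (ρ : Fin n → Fin m) (M : ATm n) :
    M.weaken.rename (liftRen ρ) = (M.rename ρ).weaken := by
  simp only [weaken, rename_eq_subst _ (rename _ _), subst_rename, liftRen_succ]

theorem lift_rename {n m l : ℕ} (θ : Fin n → ATm m) (ρ : Fin m → Fin l) :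
    lift (fun i => (θ i).rename ρ) = fun i => (lift θ i).rename (liftRen ρ) := by
  funext i
  cases i using Fin.cases <;> simp [rename_weaken, rename]

theorem rename_subst {n m l : ℕ} (θ : Fin n → ATm m) (ρ : Fin m → Fin l) (M : ATm n) :
    (M.subst θ).rename ρ = M.subst (fun i => (θ i).rename ρ) := by
  induction M generalizing m l <;> simp [subst, rename, lift_rename, *]

theorem subst_lift_weaken {n m : ℕ} (θ : Fin n → ATm m) (M : ATm n) :
    M.weaken.subst (lift θ) = (M.subst θ).weaken := by
  simp only [weaken, subst_rename, rename_subst, lift_succ]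

theorem lift_subst {n m l : ℕ} (θ : Fin n → ATm m) (τ : Fin m → ATm l) :
    lift (fun i => (θ i).subst τ) = fun i => (lift θ i).subst (lift τ) := by
  funext i
  cases i using Fin.cases <;> simp [subst_lift_weaken, subst]

theorem subst_subst {n m l : ℕ} (θ : Fin n → ATm m) (τ : Fin m → ATm l) (M : ATm n) :
    (M.subst θ).subst τ = M.subst (fun i => (θ i).subst τ) := by
  induction M generalizing m l <;> simp [subst, lift_subst, *]

theorem inst_weaken {n : ℕ} (M N : ATm n) : M.weaken.inst N = M := by
  simp [weaken, inst, subst_rename, subst_var]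

/-- The body of a binder, substituted under the binder and then instantiated, is the body
under the extended substitution. -/
theorem inst_subst_lift {n m : ℕ} (θ : Fin n → ATm m) (M : ATm m) (N : ATm (n + 1)) :
    (N.subst (lift θ)).inst M = N.subst (Fin.cons M θ) := by
  rw [inst, subst_subst]
  congr 1
  funext i
  cases i using Fin.cases with
  | zero => simp [subst]
  | succ i => exact inst_weaken _ _

theorem inst₂_subst_lift {n m : ℕ} (θ : Fin n → ATm m) (M₁ M₂ : ATm m) (N : ATm (n + 2)) :
    (N.subst (lift (lift θ))).inst₂ M₁ M₂ = N.subst (Fin.cons M₂ (Fin.cons M₁ θ)) := by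
  rw [inst₂, subst_subst]
  congr 1
  funext i
  cases i using Fin.cases with
  | zero => simp [subst]
  | succ i =>
    cases i using Fin.cases with
    | zero => rfl
    | succ i => simp [weaken, subst_rename, subst_var]

end ATm

namespace CTm

@[simp] theorem lift_zero {n m : ℕ} (θ : Fin n → CTm m) : lift θ 0 = .var 0 := rfl

@[simp] theorem lift_succ {n m : ℕ} (θ : Fin n → CTm m) (i : Fin n) :
    lift θ i.succ = (θ i).weaken := rfl

theorem lift_comp_liftRen {n m l : ℕ} (ρ : Fin n → Fin m) (θ : Fin m → CTm l) :
    lift (fun i => θ (ρ i)) = fun i => lift θ (liftRen ρ i) := by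
  funext i
  cases i using Fin.cases <;> simp

theorem lift_var {n : ℕ} : lift (var : Fin n → CTm n) = var := by
  funext i
  cases i using Fin.cases <;> simp [weaken, rename]

theorem lift_var_comp {n m : ℕ} (ρ : Fin n → Fin m) :
    lift (fun i => .var (ρ i)) = fun i => .var (liftRen ρ i) := by
  funext i
  cases i using Fin.cases <;> simp [weaken, rename]

theorem subst_var {n : ℕ} (M : CTm n) : M.subst var = M := by
  induction M <;> simp [subst, lift_var, *]

theorem rename_eq_subst {n m : ℕ} (ρ : Fin n → Fin m) (M : CTm n) :
    M.rename ρ = M.subst (fun i => .var (ρ i)) := by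
  induction M generalizing m <;> simp [subst, rename, lift_var_comp, *]

theorem subst_rename {n m l : ℕ} (ρ : Fin n → Fin m) (θ : Fin m → CTm l) (M : CTm n) :
    (M.rename ρ).subst θ = M.subst (fun i => θ (ρ i)) := by
  induction M generalizing m l <;> simp [subst, rename, lift_comp_liftRen, *]

theorem rename_weaken {n m : ℕ} (ρ : Fin n → Fin m) (M : CTm n) :
    M.weaken.rename (liftRen ρ) = (M.rename ρ).weaken := by
  simp only [weaken, rename_eq_subst _ (rename _ _), subst_rename, liftRen_succ]

theorem lift_rename {n m l : ℕ} (θ : Fin n → CTm m) (ρ : Fin m → Fin l) :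
    lift (fun i => (θ i).rename ρ) = fun i => (lift θ i).rename (liftRen ρ) := by
  funext i
  cases i using Fin.cases <;> simp [rename_weaken, rename]

theorem rename_subst {n m l : ℕ} (θ : Fin n → CTm m) (ρ : Fin m → Fin l) (M : CTm n) :
    (M.subst θ).rename ρ = M.subst (fun i => (θ i).rename ρ) := by
  induction M generalizing m l <;> simp [subst, rename, lift_rename, *]

theorem subst_lift_weaken {n m : ℕ} (θ : Fin n → CTm m) (M : CTm n) :
    M.weaken.subst (lift θ) = (M.subst θ).weaken := by
  simp only [weaken, subst_rename, rename_subst, lift_succ]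

theorem lift_subst {n m l : ℕ} (θ : Fin n → CTm m) (τ : Fin m → CTm l) :
    lift (fun i => (θ i).subst τ) = fun i => (lift θ i).subst (lift τ) := by
  funext i
  cases i using Fin.cases <;> simp [subst_lift_weaken, subst]

theorem subst_subst {n m l : ℕ} (θ : Fin n → CTm m) (τ : Fin m → CTm l) (M : CTm n) :
    (M.subst θ).subst τ = M.subst (fun i => (θ i).subst τ) := by
  induction M generalizing m l <;> simp [subst, lift_subst, *]

theorem inst_weaken {n : ℕ} (M N : CTm n) : M.weaken.inst N = M := by
  simp [weaken, inst, subst_rename, subst_var]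

/-- The body of a binder, substituted under the binder and then instantiated, is the body
under the extended substitution. -/
theorem inst_subst_lift {n m : ℕ} (θ : Fin n → CTm m) (M : CTm m) (N : CTm (n + 1)) :
    (N.subst (lift θ)).inst M = N.subst (Fin.cons M θ) := by
  rw [inst, subst_subst]
  congr 1
  funext i
  cases i using Fin.cases with
  | zero => simp [subst]
  | succ i => exact inst_weaken _ _

theorem subst_inst {n m : ℕ} (Θ : Fin n → CTm m) (E : CTm (n + 1)) (E' : CTm n) :
    (E.inst E').subst Θ = E.subst (Fin.cons (E'.subst Θ) Θ) := by
  rw [inst, subst_subst]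
  congr 1
  funext i
  cases i using Fin.cases <;> simp [subst]

theorem subst_inst₂ {n m : ℕ} (Θ : Fin n → CTm m) (E : CTm (n + 2)) (E₁ E₂ : CTm n) :
    (E.inst₂ E₁ E₂).subst Θ = E.subst (Fin.cons (E₂.subst Θ) (Fin.cons (E₁.subst Θ) Θ)) := by
  rw [inst₂, subst_subst]
  congr 1
  funext i
  cases i using Fin.cases with
  | zero => rfl
  | succ i => cases i using Fin.cases <;> simp [subst]

end CTm

/-! ### Arithmetic of credits and costs -/

@[simp] theorem credit_top : credit ⊤ = ⊤ := rfl

@[simp] theorem credit_coe (m : ℕ) : credit (m : ℕ∞) = (m : ZInf) := rfl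

@[simp] theorem credit_zero : credit 0 = 0 := rfl

theorem credit_add (a b : ℕ∞) : credit (a + b) = credit a + credit b := by
  induction a using ENat.recTopCoe with
  | top => rfl
  | coe m =>
    induction b using ENat.recTopCoe with
    | top => rw [add_top, credit_top, WithTop.add_top]
    | coe l => simp only [← Nat.cast_add, credit_coe]

theorem ZInf.natCast_nonneg (n : ℕ) : (0 : ZInf) ≤ n :=
  WithTop.coe_le_coe.2 (WithBot.coe_le_coe.2 (Int.natCast_nonneg n))

theorem credit_nonneg (a : ℕ∞) : 0 ≤ credit a := by
  induction a using ENat.recTopCoe with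
  | top => exact le_top
  | coe m => exact ZInf.natCast_nonneg m

theorem credit_mono {a b : ℕ∞} (h : a ≤ b) : credit a ≤ credit b := by
  obtain ⟨c, rfl⟩ := le_iff_exists_add.1 h
  rw [credit_add]
  exact le_add_of_nonneg_right (credit_nonneg c)

theorem credit_natCast_mul (m : ℕ) (a : ℕ∞) : credit (m * a) = m • credit a := by
  induction m with
  | zero => simp
  | succ m ih => rw [Nat.cast_succ, add_mul, one_mul, credit_add, ih, succ_nsmul]

theorem le_of_credit_le {a b : ℕ∞} (h : credit a ≤ credit b) : a ≤ b := by
  induction b using ENat.recTopCoe with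
  | top => exact le_top
  | coe l =>
    induction a using ENat.recTopCoe with
    | top => exact absurd (top_le_iff.1 h) (WithTop.coe_ne_top)
    | coe m => simpa using h

theorem credit_injective {a b : ℕ∞} (h : credit a = credit b) : a = b :=
  (le_of_credit_le h.le).antisymm (le_of_credit_le h.ge)

/-- The extended integers above a credit amount are credit amounts. -/
theorem exists_credit_eq {c : ℕ∞} {x : ZInf} (h : credit c ≤ x) :
    ∃ c', c ≤ c' ∧ credit c' = x := by
  have key : ∃ c', credit c' = x := by
    have h0 := (credit_nonneg c).trans h
    induction x using WithTop.recTopCoe with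
    | top => exact ⟨⊤, rfl⟩
    | coe y =>
      induction y using WithBot.recBotCoe with
      | bot => exact absurd h0 (by decide)
      | coe z =>
        obtain ⟨m, rfl⟩ := Int.eq_ofNat_of_zero_le (WithBot.coe_le_coe.1 (WithTop.coe_le_coe.1 h0))
        exact ⟨m, rfl⟩
  obtain ⟨c', rfl⟩ := key
  exact ⟨c', le_of_credit_le h, rfl⟩

/-- Spending credits leaves at least what was there besides them; when `l = ∞` the right-hand
side is `∞`, since `∞` absorbs `-∞`. -/
theorem credit_le_add_negCredit (a l : ℕ∞) : credit a ≤ credit (a + l) + negCredit l := by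
  induction l using ENat.recTopCoe with
  | top => rw [add_top, credit_top, WithTop.top_add]; exact le_top
  | coe m =>
    have h : credit (m : ℕ∞) + negCredit m = 0 := by
      change (((m + -m : ℤ) : WithBot ℤ) : ZInf) = 0
      rw [add_neg_cancel]
      rfl
    rw [credit_add, add_assoc, h, add_zero]

theorem scale_natCast (m : ℕ) (h : (m : ℕ∞) ≠ 0) (r : ZInf) : scale ⟨m, h⟩ r = m • r := rfl

theorem scale_top (h : (⊤ : ℕ∞) ≠ 0) (r : ZInf) :
    scale ⟨⊤, h⟩ r = if r < 0 then ⊥ else if r = 0 then 0 else ⊤ := rfl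

@[simp] theorem scale_zero (k : Mult) : scale k 0 = 0 := by
  obtain ⟨k, hk⟩ := k
  induction k using ENat.recTopCoe with
  | top => simp [scale_top]
  | coe m => rw [scale_natCast, smul_zero]

/-- Multiplication by `k` distributes over the change `r` of a number of credits, except that
for `k = ∞` the right-hand side may be `∞` instead of a smaller amount. -/
theorem credit_mul_le (k : Mult) {a a' : ℕ∞} {r : ZInf} (h : credit a' = credit a + r) :
    credit (k.1 * a') ≤ credit (k.1 * a) + scale k r := by
  obtain ⟨k, hk⟩ := k
  induction k using ENat.recTopCoe with
  | top =>
    rcases eq_or_ne a 0 with rfl | ha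
    · rw [credit_zero, zero_add] at h
      subst h
      rw [mul_zero, credit_zero, zero_add, scale_top, if_neg (credit_nonneg a').not_gt]
      split_ifs with h0
      · rw [credit_injective (h0.trans credit_zero.symm), mul_zero, credit_zero]
      · exact le_top
    · rw [ENat.top_mul ha, credit_top, WithTop.top_add]
      exact le_top
  | coe m => rw [scale_natCast, credit_natCast_mul, credit_natCast_mul, h, nsmul_add]

/-- Scaling only the credit component of a cost gives less than scaling the whole cost. -/
theorem natCast_add_scale_le (k : Mult) (n : ℕ) (r : ZInf) :
    (n : ZInf) + scale k r ≤ scale k (n + r) := by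
  obtain ⟨k, hk⟩ := k
  have hn : (0 : ZInf) ≤ n := ZInf.natCast_nonneg n
  induction k using ENat.recTopCoe with
  | top =>
    rcases lt_trichotomy r 0 with hr | rfl | hr
    · have : (n : ZInf) + scale ⟨⊤, hk⟩ r = ⊥ := by
        rw [scale_top, if_pos hr]
        rfl
      rw [this]
      exact bot_le
    · rw [scale_zero, add_zero, scale_top, if_neg hn.not_gt]
      split_ifs with h0
      · exact h0.le
      · exact le_top
    · have : 0 < (n : ZInf) + r := hr.trans_le (le_add_of_nonneg_left hn)
      rw [scale_top _ (n + r), if_neg this.not_gt, if_neg this.ne']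
      exact le_top
  | coe m =>
    rw [scale_natCast, scale_natCast, nsmul_add]
    gcongr
    exact le_self_nsmul hn (by simpa using hk)

/-! ### Resource terms -/

namespace Res

variable {n m : ℕ}

theorem ext_mono {f g : Res n} (h : f ≤ g) (a : ℕ∞) : f.ext a ≤ g.ext a := by
  refine ⟨fun i => ?_, h.2⟩
  cases i using Fin.cases with
  | zero => exact le_rfl
  | succ i => exact h.1 i

theorem bank_add (a b : ℕ∞) : (bank (a + b) : Res n) = bank a + bank b := by
  simp [bank]

theorem smul_bank (k a : ℕ∞) : k • (bank a : Res n) = bank (k * a) := by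
  simp [bank]

theorem bank_mono {a b : ℕ∞} (h : a ≤ b) : (bank a : Res n) ≤ bank b := ⟨le_rfl, h⟩

/-- Substitution of the resource terms `τ i` for the variables of a resource term. -/
def subst (τ : Fin n → Res m) (f : Res n) : Res m := ∑ i, f.1 i • τ i + bank f.2

/-- Extension of a substitution of resource terms under a binder. -/
def lift (τ : Fin n → Res m) : Fin (n + 1) → Res (m + 1) :=
  Fin.cons (var 0) (fun i => (τ i).ext 0)

theorem subst_add (τ : Fin n → Res m) (f g : Res n) :
    (f + g).subst τ = f.subst τ + g.subst τ := by
  simp only [subst, Prod.fst_add, Prod.snd_add, Pi.add_apply, add_smul, Finset.sum_add_distrib,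
    bank_add]
  abel

theorem subst_smul (τ : Fin n → Res m) (k : ℕ∞) (f : Res n) :
    (k • f).subst τ = k • f.subst τ := by
  simp only [subst, Prod.smul_fst, Prod.smul_snd, Pi.smul_apply, smul_add, Finset.smul_sum,
    smul_eq_mul, mul_smul, smul_bank]

theorem subst_bank (τ : Fin n → Res m) (l : ℕ∞) : (bank l).subst τ = bank l := by
  simp [subst, bank]

theorem subst_mono (τ : Fin n → Res m) {f g : Res n} (h : f ≤ g) : f.subst τ ≤ g.subst τ := by
  obtain ⟨t, rfl⟩ := le_iff_exists_add.1 h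
  rw [subst_add]
  exact le_self_add

theorem subst_var (τ : Fin n → Res m) (i : Fin n) : (var i).subst τ = τ i := by
  simp [subst, var, bank, Pi.single_apply, ite_smul, ← Prod.zero_eq_mk]

theorem subst_ext (τ : Fin n → Res m) (f : Res n) (a : ℕ∞) :
    (f.ext a).subst (lift τ) = (f.subst τ).ext a := by
  simp only [subst, ext, lift, Fin.sum_univ_succ, Fin.cons_zero, Fin.cons_succ]
  ext j
  · cases j using Fin.cases <;> simp [var, bank, Prod.fst_sum, Finset.sum_apply]
  · simp [var, bank, Prod.snd_sum]

theorem lift_var_comp (ρ : Fin n → Fin m) :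
    lift (fun i => var (ρ i)) = fun i => var (liftRen ρ i) := by
  funext i
  cases i using Fin.cases with
  | zero => rfl
  | succ i =>
    ext j
    · cases j using Fin.cases <;> simp [lift, ext, var, Pi.single_apply]
    · rfl

theorem subst_var_succ (f : Res n) : f.subst (fun i => var i.succ) = f.ext 0 := by
  ext j
  · cases j using Fin.cases with
    | zero =>
      simp [subst, ext, var, bank, Prod.fst_sum, Finset.sum_apply, Fin.succ_ne_zero, eq_comm]
    | succ j => simp [subst, ext, var, bank, Prod.fst_sum, Finset.sum_apply, Pi.single_apply]
  · simp [subst, ext, var, bank, Prod.snd_sum]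

theorem subst_bank_comp (f : Res n) (σ : Fin n → ℕ∞) :
    f.subst (fun i => (bank (σ i) : Res m)) = bank (f.eval σ) := by
  simp only [subst, smul_bank, eval, bank_add]
  congr 1
  simp only [bank]
  ext <;> simp [Prod.fst_sum, Prod.snd_sum]

theorem eval_add (f g : Res n) (σ : Fin n → ℕ∞) : (f + g).eval σ = f.eval σ + g.eval σ := by
  simp only [eval, Prod.fst_add, Prod.snd_add, Pi.add_apply, add_mul, Finset.sum_add_distrib]
  abel

theorem eval_smul (k : ℕ∞) (f : Res n) (σ : Fin n → ℕ∞) : (k • f).eval σ = k * f.eval σ := by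
  simp only [eval, Prod.smul_fst, Prod.smul_snd, Pi.smul_apply, mul_add, Finset.mul_sum,
    smul_eq_mul, mul_assoc]

@[simp] theorem eval_bank (l : ℕ∞) (σ : Fin n → ℕ∞) : (bank l).eval σ = l := by
  simp [eval, bank]

theorem eval_mono {f g : Res n} (h : f ≤ g) (σ : Fin n → ℕ∞) : f.eval σ ≤ g.eval σ := by
  obtain ⟨t, rfl⟩ := le_iff_exists_add.1 h
  rw [eval_add]
  exact le_self_add

theorem eval_var (i : Fin n) (σ : Fin n → ℕ∞) : (var i).eval σ = σ i := by
  simp [eval, var, Pi.single_apply]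

theorem eval_ext (f : Res n) (a d : ℕ∞) (σ : Fin n → ℕ∞) :
    (f.ext a).eval (Fin.cons d σ) = f.eval σ + a * d := by
  simp only [eval, ext, Fin.sum_univ_succ, Fin.cons_zero, Fin.cons_succ]
  abel

end Res

/-! ### Typing of the intermediate language -/

/-- A term remains typable when more resources are available. -/
theorem HasTy.mono {n : ℕ} {Γ : Ctx n} {f g : Res n} {M : ATm n} {A : Ty}
    (hM : HasTy Γ f M A) (h : f ≤ g) : HasTy Γ g M A := by
  -- where a rule splits its resources, the surplus `t` goes to one of the parts
  induction hM with
  | var i hi => exact .var i (hi.trans h)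
  | unit => exact .unit
  | pair _ h₂ ih₁ _ =>
    obtain ⟨t, rfl⟩ := le_iff_exists_add.1 h
    rw [add_right_comm]
    exact .pair (ih₁ le_self_add) h₂
  | split h₁ _ _ ih₂ =>
    obtain ⟨t, rfl⟩ := le_iff_exists_add.1 h
    rw [add_right_comm]
    exact .split h₁ (ih₂ (Res.ext_mono (Res.ext_mono le_self_add _) _))
  | inl _ ih => exact .inl (ih h)
  | inr _ ih => exact .inr (ih h)
  | case h₁ _ _ _ ih₂ ih₃ =>
    obtain ⟨t, rfl⟩ := le_iff_exists_add.1 h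
    rw [add_right_comm]
    exact .case h₁ (ih₂ (Res.ext_mono le_self_add _)) (ih₃ (Res.ext_mono le_self_add _))
  | ampPair _ _ ih₁ ih₂ => exact .ampPair (ih₁ h) (ih₂ h)
  | fst _ ih => exact .fst (ih h)
  | snd _ ih => exact .snd (ih h)
  | lam _ ih => exact .lam (ih (Res.ext_mono h _))
  | app _ h₂ ih₁ _ =>
    obtain ⟨t, rfl⟩ := le_iff_exists_add.1 h
    rw [add_right_comm]
    exact .app (ih₁ le_self_add) h₂
  | save h₁ h₂ _ => exact .save h₁ (h₂.trans h)
  | transfer h₁ _ _ ih₂ =>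
    obtain ⟨t, rfl⟩ := le_iff_exists_add.1 h
    rw [add_right_comm]
    exact .transfer h₁ (ih₂ (Res.ext_mono (add_le_add_left le_self_add _) _))
  | tick _ ih => exact .tick (ih h)
  | create _ ih => exact .create (ih (add_le_add_left h _))
  | spend _ ih =>
    obtain ⟨t, rfl⟩ := le_iff_exists_add.1 h
    rw [add_right_comm]
    exact .spend (ih le_self_add)
  | zero => exact .zero
  | succ _ ih => exact .succ (ih h)
  | nrec _ h₂ h₃ ih₁ _ _ =>
    obtain ⟨t, rfl⟩ := le_iff_exists_add.1 h
    rw [add_right_comm, add_right_comm _ _ t]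
    exact .nrec (ih₁ le_self_add) h₂ h₃
  | nil => exact .nil
  | cons _ h₂ ih₁ _ =>
    obtain ⟨t, rfl⟩ := le_iff_exists_add.1 h
    rw [add_right_comm]
    exact .cons (ih₁ le_self_add) h₂
  | lrec _ h₂ h₃ ih₁ _ _ =>
    obtain ⟨t, rfl⟩ := le_iff_exists_add.1 h
    rw [add_right_comm, add_right_comm _ _ t]
    exact .lrec (ih₁ le_self_add) h₂ h₃

/-- Typing is preserved by every class `P` of well-typed substitutions that is closed under
extension under a binder.  Renamings form such a class, which makes weakening available for the
class of all well-typed substitutions. -/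
theorem HasTy.subst_of_class
    (P : ∀ {n m : ℕ}, Ctx n → Ctx m → (Fin n → Res m) → (Fin n → ATm m) → Prop)
    (hty : ∀ {n m : ℕ} {Γ : Ctx n} {Δ : Ctx m} {τ : Fin n → Res m} {θ : Fin n → ATm m},
      P Γ Δ τ θ → ∀ i, HasTy Δ (τ i) (θ i) (Γ i))
    (hlift : ∀ {n m : ℕ} {Γ : Ctx n} {Δ : Ctx m} {τ : Fin n → Res m} {θ : Fin n → ATm m}
      (A : Ty), P Γ Δ τ θ → P (Γ.ext A) (Δ.ext A) (Res.lift τ) (ATm.lift θ))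
    {n m : ℕ} {Γ : Ctx n} {Δ : Ctx m} {f : Res n} {τ : Fin n → Res m} {θ : Fin n → ATm m}
    {M : ATm n} {A : Ty} (hM : HasTy Γ f M A) (h : P Γ Δ τ θ) :
    HasTy Δ (f.subst τ) (M.subst θ) A := by
  induction hM generalizing m with
  | var i hi => exact (hty h i).mono (Res.subst_var τ i ▸ Res.subst_mono τ hi)
  | unit => exact .unit
  | pair _ _ ih₁ ih₂ =>
    rw [Res.subst_add]
    exact .pair (ih₁ h) (ih₂ h)
  | split _ _ ih₁ ih₂ =>
    rw [Res.subst_add, Res.subst_smul]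
    refine .split (ih₁ h) ?_
    rw [← Res.subst_ext, ← Res.subst_ext]
    exact ih₂ (hlift _ (hlift _ h))
  | inl _ ih => exact .inl (ih h)
  | inr _ ih => exact .inr (ih h)
  | case _ _ _ ih₁ ih₂ ih₃ =>
    rw [Res.subst_add, Res.subst_smul]
    refine .case (ih₁ h) ?_ ?_ <;> rw [← Res.subst_ext]
    · exact ih₂ (hlift _ h)
    · exact ih₃ (hlift _ h)
  | ampPair _ _ ih₁ ih₂ => exact .ampPair (ih₁ h) (ih₂ h)
  | fst _ ih => exact .fst (ih h)
  | snd _ ih => exact .snd (ih h)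
  | lam _ ih => exact .lam (Res.subst_ext τ _ _ ▸ ih (hlift _ h))
  | app _ _ ih₁ ih₂ =>
    rw [Res.subst_add]
    exact .app (ih₁ h) (ih₂ h)
  | save _ h₂ ih =>
    refine .save (ih h) ?_
    rw [← Res.subst_smul, ← Res.subst_bank τ, ← Res.subst_add]
    exact Res.subst_mono τ h₂
  | transfer _ _ ih₁ ih₂ =>
    rw [Res.subst_add, Res.subst_smul]
    refine .transfer (ih₁ h) ?_
    rw [← Res.subst_bank τ, ← Res.subst_add, ← Res.subst_ext]
    exact ih₂ (hlift _ h)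
  | tick _ ih => exact .tick (ih h)
  | create _ ih =>
    refine .create ?_
    rw [← Res.subst_bank τ, ← Res.subst_add]
    exact ih h
  | spend _ ih =>
    rw [Res.subst_add, Res.subst_bank]
    exact .spend (ih h)
  | zero => exact .zero
  | succ _ ih => exact .succ (ih h)
  | nrec _ _ _ ih₁ ih₂ ih₃ =>
    rw [Res.subst_add, Res.subst_add]
    exact .nrec (ih₁ h) (ih₂ h) (ih₃ h)
  | nil => exact .nil
  | cons _ _ ih₁ ih₂ =>
    rw [Res.subst_add]
    exact .cons (ih₁ h) (ih₂ h)
  | lrec _ _ _ ih₁ ih₂ ih₃ =>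
    rw [Res.subst_add, Res.subst_add]
    exact .lrec (ih₁ h) (ih₂ h) (ih₃ h)

theorem HasTy.rename {n m : ℕ} {Γ : Ctx n} {Δ : Ctx m} {f : Res n} {M : ATm n} {A : Ty}
    (hM : HasTy Γ f M A) {ρ : Fin n → Fin m} (h : ∀ i, Δ (ρ i) = Γ i) :
    HasTy Δ (f.subst (fun i => Res.var (ρ i))) (M.rename ρ) A := by
  rw [ATm.rename_eq_subst]
  refine hM.subst_of_class (fun {n m} Γ Δ τ θ => ∃ ρ : Fin n → Fin m,
    (∀ i, Δ (ρ i) = Γ i) ∧ τ = (fun i => Res.var (ρ i)) ∧ θ = fun i => .var (ρ i))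
    ?_ ?_ ⟨ρ, h, rfl, rfl⟩
  · rintro n m Γ Δ _ _ ⟨ρ, h, rfl, rfl⟩ i
    exact h i ▸ .var _ le_rfl
  · rintro n m Γ Δ _ _ A ⟨ρ, h, rfl, rfl⟩
    refine ⟨liftRen ρ, fun i => ?_, Res.lift_var_comp ρ, ATm.lift_var_comp ρ⟩
    cases i using Fin.cases with
    | zero => rfl
    | succ i => exact h i

theorem HasTy.weaken {n : ℕ} {Γ : Ctx n} {f : Res n} {M : ATm n} {A : Ty}
    (hM : HasTy Γ f M A) (B : Ty) : HasTy (Γ.ext B) (f.ext 0) M.weaken A := by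
  rw [← Res.subst_var_succ]
  exact hM.rename fun _ => rfl

theorem HasTy.subst {n m : ℕ} {Γ : Ctx n} {Δ : Ctx m} {f : Res n} {τ : Fin n → Res m}
    {θ : Fin n → ATm m} {M : ATm n} {A : Ty} (hM : HasTy Γ f M A)
    (h : ∀ i, HasTy Δ (τ i) (θ i) (Γ i)) : HasTy Δ (f.subst τ) (M.subst θ) A := by
  refine hM.subst_of_class (fun Γ Δ τ θ => ∀ i, HasTy Δ (τ i) (θ i) (Γ i)) (fun h => h) ?_ h
  intro n m Γ Δ τ θ A h i
  cases i using Fin.cases with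
  | zero => exact .var 0 le_rfl
  | succ i => exact (h i).weaken A

theorem HasTy.subst_closed {n : ℕ} {Γ : Ctx n} {f : Res n} {σ : Fin n → ℕ∞}
    {θ : Fin n → ATm 0} {M : ATm n} {A : Ty} (hM : HasTy Γ f M A)
    (h : ∀ i, ClosedTy (σ i) (θ i) (Γ i)) : ClosedTy (f.eval σ) (M.subst θ) A := by
  rw [ClosedTy, ← Res.subst_bank_comp]
  exact hM.subst h

theorem ClosedTy.mono {a b : ℕ∞} {M : ATm 0} {A : Ty} (hM : ClosedTy a M A) (h : a ≤ b) :
    ClosedTy b M A :=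
  HasTy.mono hM (Res.bank_mono h)

/-! ### Typing of the recurrence language -/

/-- Typing is preserved by every class `P` of well-typed substitutions that is closed under
extension under a binder. -/
theorem CHasTy.subst_of_class
    (P : ∀ {n m : ℕ}, CCtx n → CCtx m → (Fin n → CTm m) → Prop)
    (hty : ∀ {n m : ℕ} {Γ : CCtx n} {Δ : CCtx m} {Θ : Fin n → CTm m},
      P Γ Δ Θ → ∀ i, CHasTy Δ (Θ i) (Γ i))
    (hlift : ∀ {n m : ℕ} {Γ : CCtx n} {Δ : CCtx m} {Θ : Fin n → CTm m}
      (T : CTy), P Γ Δ Θ → P (Γ.ext T) (Δ.ext T) (CTm.lift Θ))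
    {n m : ℕ} {Γ : CCtx n} {Δ : CCtx m} {Θ : Fin n → CTm m}
    {E : CTm n} {T : CTy} (hE : CHasTy Γ E T) (h : P Γ Δ Θ) :
    CHasTy Δ (E.subst Θ) T := by
  induction hE generalizing m with
  | var i => exact hty h i
  | const c => exact .const c
  | add _ _ ih₁ ih₂ => exact .add (ih₁ h) (ih₂ h)
  | smul _ ih => exact .smul (ih h)
  | unit => exact .unit
  | pair _ _ ih₁ ih₂ => exact .pair (ih₁ h) (ih₂ h)
  | fst _ ih => exact .fst (ih h)
  | snd _ ih => exact .snd (ih h)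
  | inl _ ih => exact .inl (ih h)
  | inr _ ih => exact .inr (ih h)
  | case _ _ _ ih₁ ih₂ ih₃ => exact .case (ih₁ h) (ih₂ (hlift _ h)) (ih₃ (hlift _ h))
  | lam _ ih => exact .lam (ih (hlift _ h))
  | app _ _ ih₁ ih₂ => exact .app (ih₁ h) (ih₂ h)
  | zero => exact .zero
  | succ _ ih => exact .succ (ih h)
  | nrec _ _ _ ih₁ ih₂ ih₃ => exact .nrec (ih₁ h) (ih₂ h) (ih₃ h)
  | nil => exact .nil
  | cons _ _ ih₁ ih₂ => exact .cons (ih₁ h) (ih₂ h)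
  | lrec _ _ _ ih₁ ih₂ ih₃ => exact .lrec (ih₁ h) (ih₂ h) (ih₃ h)

theorem CHasTy.rename {n m : ℕ} {Γ : CCtx n} {Δ : CCtx m} {E : CTm n} {T : CTy}
    (hE : CHasTy Γ E T) {ρ : Fin n → Fin m} (h : ∀ i, Δ (ρ i) = Γ i) :
    CHasTy Δ (E.rename ρ) T := by
  rw [CTm.rename_eq_subst]
  refine hE.subst_of_class (fun {n m} Γ Δ Θ => ∃ ρ : Fin n → Fin m,
    (∀ i, Δ (ρ i) = Γ i) ∧ Θ = fun i => .var (ρ i)) ?_ ?_ ⟨ρ, h, rfl⟩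
  · rintro n m Γ Δ _ ⟨ρ, h, rfl⟩ i
    exact h i ▸ .var _
  · rintro n m Γ Δ _ T ⟨ρ, h, rfl⟩
    refine ⟨liftRen ρ, fun i => ?_, CTm.lift_var_comp ρ⟩
    cases i using Fin.cases with
    | zero => rfl
    | succ i => exact h i

theorem CHasTy.weaken {n : ℕ} {Γ : CCtx n} {E : CTm n} {T : CTy}
    (hE : CHasTy Γ E T) (T' : CTy) : CHasTy (Γ.ext T') E.weaken T :=
  hE.rename fun _ => rfl

theorem CHasTy.lift {n m : ℕ} {Γ : CCtx n} {Δ : CCtx m} {Θ : Fin n → CTm m}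
    (h : ∀ i, CHasTy Δ (Θ i) (Γ i)) (T : CTy) (i : Fin (n + 1)) :
    CHasTy (Δ.ext T) (CTm.lift Θ i) (Γ.ext T i) := by
  cases i using Fin.cases with
  | zero => exact .var 0
  | succ i => exact (h i).weaken T

theorem CHasTy.subst {n m : ℕ} {Γ : CCtx n} {Δ : CCtx m} {Θ : Fin n → CTm m}
    {E : CTm n} {T : CTy} (hE : CHasTy Γ E T)
    (h : ∀ i, CHasTy Δ (Θ i) (Γ i)) : CHasTy Δ (E.subst Θ) T :=
  hE.subst_of_class (fun Γ Δ Θ => ∀ i, CHasTy Δ (Θ i) (Γ i)) (fun h => h)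
    (fun T h => CHasTy.lift h T) h

theorem CHasTy.cons_subst {n m : ℕ} {Γ : CCtx n} {Δ : CCtx m} {Θ : Fin n → CTm m}
    (h : ∀ i, CHasTy Δ (Θ i) (Γ i)) {E : CTm m} {T : CTy} (hE : CHasTy Δ E T)
    (i : Fin (n + 1)) : CHasTy Δ ((Fin.cons E Θ : Fin (n + 1) → CTm m) i) (Γ.ext T i) := by
  cases i using Fin.cases with
  | zero => exact hE
  | succ i => exact h i

theorem CHasTy.inst {n : ℕ} {Γ : CCtx n} {E : CTm (n + 1)} {E' : CTm n} {T T' : CTy}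
    (hE : CHasTy (Γ.ext T) E T') (hE' : CHasTy Γ E' T) : CHasTy Γ (E.inst E') T' :=
  hE.subst (CHasTy.cons_subst .var hE')

theorem CHasTy.addc {n : ℕ} {Γ : CCtx n} {E E' : CTm n} {T : CTy}
    (h : CHasTy Γ E .cost) (h' : CHasTy Γ E' (.prod .cost T)) :
    CHasTy Γ (CTm.addc E E') (.prod .cost T) :=
  .pair (.add h (.fst h')) (.snd h')

/-- Both sides of an inequality are well typed. -/
theorem CLe.wellTyped {n : ℕ} {Γ : CCtx n} {T : CTy} {E E' : CTm n} (h : CLe Γ T E E') :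
    CHasTy Γ E T ∧ CHasTy Γ E' T := by
  induction h with
  | refl h => exact ⟨h, h⟩
  | trans _ _ ih₁ ih₂ => exact ⟨ih₁.1, ih₂.2⟩
  | fst_congr _ ih => exact ⟨.fst ih.1, .fst ih.2⟩
  | snd_congr _ ih => exact ⟨.snd ih.1, .snd ih.2⟩
  | case_congr _ h₁ h₂ ih => exact ⟨.case ih.1 h₁ h₂, .case ih.2 h₁ h₂⟩
  | app_congr _ h ih => exact ⟨.app ih.1 h, .app ih.2 h⟩
  | nrec_congr _ h₁ h₂ ih => exact ⟨.nrec ih.1 h₁ h₂, .nrec ih.2 h₁ h₂⟩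
  | lrec_congr _ h₁ h₂ ih => exact ⟨.lrec ih.1 h₁ h₂, .lrec ih.2 h₁ h₂⟩
  | fst_beta h₁ h₂ => exact ⟨h₁, .fst (.pair h₁ h₂)⟩
  | snd_beta h₁ h₂ => exact ⟨h₂, .snd (.pair h₁ h₂)⟩
  | inl_beta h h₁ h₂ => exact ⟨h₁.inst h, .case (.inl h) h₁ h₂⟩
  | inr_beta h h₁ h₂ => exact ⟨h₂.inst h, .case (.inr h) h₁ h₂⟩
  | lam_beta h₁ h₂ => exact ⟨h₁.inst h₂, .app (.lam h₁) h₂⟩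
  | zero_beta h₁ h₂ => exact ⟨.app h₁ .unit, .nrec .zero h₁ h₂⟩
  | succ_beta h h₁ h₂ => exact ⟨.app h₂ (.pair h (.nrec h h₁ h₂)), .nrec (.succ h) h₁ h₂⟩
  | nil_beta h₁ h₂ => exact ⟨.app h₁ .unit, .lrec .nil h₁ h₂⟩
  | cons_beta h h' h₁ h₂ =>
    exact ⟨.app h₂ (.pair h (.pair h' (.lrec h' h₁ h₂))), .lrec (.cons h h') h₁ h₂⟩
  | add_congr _ _ ih₁ ih₂ => exact ⟨.add ih₁.1 ih₂.1, .add ih₁.2 ih₂.2⟩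
  | smul_congr _ ih => exact ⟨.smul ih.1, .smul ih.2⟩
  | add_comm h₁ h₂ => exact ⟨.add h₁ h₂, .add h₂ h₁⟩
  | add_assoc h₁ h₂ h₃ => exact ⟨.add (.add h₁ h₂) h₃, .add h₁ (.add h₂ h₃)⟩
  | add_assoc' h₁ h₂ h₃ => exact ⟨.add h₁ (.add h₂ h₃), .add (.add h₁ h₂) h₃⟩
  | zero_add h => exact ⟨.add (.const 0) h, h⟩
  | zero_add' h => exact ⟨h, .add (.const 0) h⟩
  | const _ => exact ⟨.const _, .const _⟩
  | const_add c c' => exact ⟨.const _, .add (.const c) (.const c')⟩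
  | const_add' c c' => exact ⟨.add (.const c) (.const c'), .const _⟩
  | const_smul k c => exact ⟨.const _, .smul (.const c)⟩
  | const_smul' k c => exact ⟨.smul (.const c), .const _⟩

/-! ### Typing of extracted recurrences -/

/-- The context of potential types `⟨⟨Γ⟩⟩`. -/
def potCtx {n : ℕ} (Γ : Ctx n) : CCtx n := fun i => pot (Γ i)

theorem potCtx_ext {n : ℕ} (Γ : Ctx n) (A : Ty) :
    potCtx (Γ.ext A) = (potCtx Γ).ext (pot A) := by
  funext i
  cases i using Fin.cases <;> rfl

/-- The step function `λ p. E (π₁ p, λ z. π₂ p)` of the recursor extracted from `nrec`. -/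
def CTm.nrecStep {n : ℕ} (E : CTm n) : CTm n :=
  .lam (.app E.weaken (.pair (.fst (.var 0)) (.lam (.snd (.var 1)))))

/-- The step function `λ p. E (π₁ p, ((0, π₁ π₂ p), π₂ π₂ p))` of the recursor extracted from
`lrec`. -/
def CTm.lrecStep {n : ℕ} (E : CTm n) : CTm n :=
  .lam (.app E.weaken (.pair (.fst (.var 0))
    (.pair (.pair (.const 0) (.fst (.snd (.var 0)))) (.snd (.snd (.var 0))))))

theorem CHasTy.nrecStep {n : ℕ} {Γ : CCtx n} {E : CTm n} {T : CTy}
    (h : CHasTy Γ E (.arr (.prod .nat (.arr .one T)) T)) :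
    CHasTy Γ E.nrecStep (.arr (.prod .nat T) T) :=
  .lam (.app (h.weaken _) (.pair (.fst (T' := T) (.var 0))
    (.lam (.snd (T := .nat) (.var 1)))))

theorem CHasTy.lrecStep {n : ℕ} {Γ : CCtx n} {E : CTm n} {T T' : CTy}
    (h : CHasTy Γ E (.arr (.prod T' (.prod (.prod .cost (.list T')) T)) T)) :
    CHasTy Γ E.lrecStep (.arr (.prod T' (.prod (.list T') T)) T) :=
  have h0 : CHasTy (Γ.ext (.prod T' (.prod (.list T') T))) (.var 0)
    (.prod T' (.prod (.list T') T)) := .var 0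
  .lam (.app (h.weaken _) (.pair (.fst h0)
    (.pair (.pair (.const 0) (.fst (.snd h0))) (.snd (.snd h0)))))

theorem CTm.subst_nrecStep {n m : ℕ} (Θ : Fin n → CTm m) (E : CTm n) :
    E.nrecStep.subst Θ = (E.subst Θ).nrecStep := by
  simp only [nrecStep, CTm.subst, subst_lift_weaken]
  rfl

theorem CTm.subst_lrecStep {n m : ℕ} (Θ : Fin n → CTm m) (E : CTm n) :
    E.lrecStep.subst Θ = (E.subst Θ).lrecStep := by
  simp only [lrecStep, CTm.subst, subst_lift_weaken]
  rfl

theorem extract_nrec_subst {n m : ℕ} (M N₁ N₂ : ATm n) (Θ : Fin n → CTm m) :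
    (extract (.nrec M N₁ N₂)).subst Θ = CTm.addc
      (.add (.add (.fst ((extract M).subst Θ)) (.fst ((extract N₁).subst Θ)))
        (.fst ((extract N₂).subst Θ)))
      (.nrec (.snd ((extract M).subst Θ)) (.snd ((extract N₁).subst Θ))
        (CTm.nrecStep (.snd ((extract N₂).subst Θ)))) := by
  have h := CTm.subst_nrecStep Θ (.snd (extract N₂))
  rw [CTm.subst] at h
  rw [← h]
  rfl

theorem extract_lrec_subst {n m : ℕ} (M N₁ N₂ : ATm n) (Θ : Fin n → CTm m) :
    (extract (.lrec M N₁ N₂)).subst Θ = CTm.addc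
      (.add (.add (.fst ((extract M).subst Θ)) (.fst ((extract N₁).subst Θ)))
        (.fst ((extract N₂).subst Θ)))
      (.lrec (.snd ((extract M).subst Θ)) (.snd ((extract N₁).subst Θ))
        (CTm.lrecStep (.snd ((extract N₂).subst Θ)))) := by
  have h := CTm.subst_lrecStep Θ (.snd (extract N₂))
  rw [CTm.subst] at h
  rw [← h]
  rfl

theorem CHasTy.extract {n : ℕ} {Γ : Ctx n} {f : Res n} {M : ATm n} {A : Ty}
    (h : HasTy Γ f M A) : CHasTy (potCtx Γ) (extract M) (cpx A) := by
  induction h with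
  | var i _ => exact .pair (.const 0) (.var i)
  | unit => exact .pair (.const 0) .unit
  | pair _ _ ih₁ ih₂ =>
    exact .pair (.add (.fst ih₁) (.fst ih₂)) (.pair (.snd ih₁) (.snd ih₂))
  | split _ _ ih₁ ih₂ =>
    rw [potCtx_ext, potCtx_ext] at ih₂
    exact .addc (.smul (.fst ih₁)) (ih₂.subst
      (cons_subst (cons_subst .var (.fst (.snd ih₁))) (.snd (.snd ih₁))))
  | inl _ ih => exact .pair (.fst ih) (.inl (.snd ih))
  | inr _ ih => exact .pair (.fst ih) (.inr (.snd ih))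
  | case _ _ _ ih₁ ih₂ ih₃ =>
    rw [potCtx_ext] at ih₂ ih₃
    exact .addc (.smul (.fst ih₁)) (.case (.snd ih₁) ih₂ ih₃)
  | ampPair _ _ ih₁ ih₂ => exact .pair (.const 0) (.pair ih₁ ih₂)
  | fst _ ih => exact .addc (.fst ih) (.fst (.snd ih))
  | snd _ ih => exact .addc (.fst ih) (.snd (.snd ih))
  | lam _ ih =>
    rw [potCtx_ext] at ih
    exact .pair (.const 0) (.lam ih)
  | app _ _ ih₁ ih₂ => exact .addc (.add (.fst ih₁) (.fst ih₂)) (.app (.snd ih₁) (.snd ih₂))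
  | save _ _ ih => exact .pair (.smul (.fst ih)) (.snd ih)
  | transfer _ _ ih₁ ih₂ =>
    rw [potCtx_ext] at ih₂
    exact .addc (.smul (.fst ih₁)) (ih₂.inst (.snd ih₁))
  | tick _ ih => exact .addc (.const _) ih
  | create _ ih => exact .addc (.const _) ih
  | spend _ ih => exact .addc (.const _) ih
  | zero => exact .pair (.const 0) .zero
  | succ _ ih => exact .pair (.fst ih) (.succ (.snd ih))
  | nrec _ _ _ ih₁ ih₂ ih₃ =>
    exact .addc (.add (.add (.fst ih₁) (.fst ih₂)) (.fst ih₃))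
      (.nrec (.snd ih₁) (.snd ih₂) (nrecStep (.snd ih₃)))
  | nil => exact .pair (.const 0) .nil
  | cons _ _ ih₁ ih₂ =>
    exact .pair (.add (.fst ih₁) (.fst ih₂)) (.cons (.snd ih₁) (.snd ih₂))
  | lrec _ _ _ ih₁ ih₂ ih₃ =>
    exact .addc (.add (.add (.fst ih₁) (.fst ih₂)) (.fst ih₃))
      (.lrec (.snd ih₁) (.snd ih₂) (lrecStep (.snd ih₃)))

/-! ### Values -/

/-- Closed values. -/
inductive IsVal : ATm 0 → Prop
  | unit : IsVal .unit
  | pair {v w : ATm 0} : IsVal v → IsVal w → IsVal (.pair v w)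
  | inl {v : ATm 0} : IsVal v → IsVal (.inl v)
  | inr {v : ATm 0} : IsVal v → IsVal (.inr v)
  | ampPair (M N : ATm 0) : IsVal (.ampPair M N)
  | lam (M : ATm 1) : IsVal (.lam M)
  | save (k : Mult) (l : ℕ∞) {v : ATm 0} : IsVal v → IsVal (.save k l v)
  | zero : IsVal .zero
  | succ {v : ATm 0} : IsVal v → IsVal (.succ v)
  | nil : IsVal .nil
  | cons {v w : ATm 0} : IsVal v → IsVal w → IsVal (.cons v w)

/-- Values evaluate to themselves, at no cost. -/
theorem IsVal.eval {v : ATm 0} (hv : IsVal v) {n : ℕ} {r : ZInf} {w : ATm 0}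
    (h : Eval v n r w) : n = 0 ∧ r = 0 ∧ w = v := by
  induction hv generalizing n r w with
  | unit | ampPair | lam | zero | nil => cases h; exact ⟨rfl, rfl, rfl⟩
  | pair _ _ ih₁ ih₂ | cons _ _ ih₁ ih₂ =>
    cases h
    rename_i h₁ h₂
    obtain ⟨rfl, rfl, rfl⟩ := ih₁ h₁
    obtain ⟨rfl, rfl, rfl⟩ := ih₂ h₂
    exact ⟨rfl, add_zero 0, rfl⟩
  | inl _ ih | inr _ ih | succ _ ih =>
    cases h
    rename_i h
    obtain ⟨rfl, rfl, rfl⟩ := ih h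
    exact ⟨rfl, rfl, rfl⟩
  | save k l _ ih =>
    cases h with
    | save h₁ =>
      obtain ⟨rfl, rfl, rfl⟩ := ih h₁
      exact ⟨rfl, scale_zero k, rfl⟩

theorem NatClause.isVal {v : ATm 0} {E : CTm 0} (h : NatClause v E) : IsVal v := by
  induction h with
  | zero _ => exact .zero
  | succ _ _ ih => exact .succ ih

theorem ListClause.isVal {A : Ty} {V : ℕ∞ → ATm 0 → CTm 0 → Prop} {a : ℕ∞} {v : ATm 0}
    {E : CTm 0} (hV : ∀ {a v E}, V a v E → IsVal v) (h : ListClause A V a v E) : IsVal v := by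
  induction h with
  | nil _ => exact .nil
  | cons _ h₁ _ ih => exact .cons (hV h₁) ih

theorem ValRel.isVal {A : Ty} {a : ℕ∞} {v : ATm 0} {E : CTm 0} (h : ValRel A a v E) :
    IsVal v := by
  induction A generalizing a v E with
  | one =>
    obtain ⟨-, -, rfl, -⟩ := h
    exact .unit
  | tensor A B ihA ihB =>
    obtain ⟨-, -, v₁, v₂, rfl, a₁, a₂, -, h₁, h₂⟩ := h
    exact .pair (ihA h₁) (ihB h₂)
  | plus A B ihA ihB =>
    obtain ⟨-, -, ⟨w, E', rfl, -, h⟩ | ⟨w, E', rfl, -, h⟩⟩ := h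
    · exact .inl (ihA h)
    · exact .inr (ihB h)
  | amp A B =>
    obtain ⟨-, -, M, N, rfl, -⟩ := h
    exact .ampPair M N
  | lolli A B =>
    obtain ⟨-, -, M, rfl, -⟩ := h
    exact .lam M
  | bang k l A ih =>
    obtain ⟨-, -, w, rfl, d, -, h⟩ := h
    exact .save k l (ih h)
  | nat => exact h.2.2.isVal
  | list A ih => exact h.2.2.isVal ih

/-! ### Monotonicity of the bounding relations -/

theorem ValRel.closedTy {A : Ty} {a : ℕ∞} {v : ATm 0} {E : CTm 0} (h : ValRel A a v E) :
    ClosedTy a v A := by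
  cases A <;> exact h.1

theorem ValRel.cHasTy {A : Ty} {a : ℕ∞} {v : ATm 0} {E : CTm 0} (h : ValRel A a v E) :
    CHasTy CCtx.nil E (pot A) := by
  cases A <;> exact h.2.1

/-- The term bounding relation inherits monotonicity from the value bounding relation. -/
theorem TermClause.mono {A : Ty} {V : ℕ∞ → ATm 0 → CTm 0 → Prop} {a b : ℕ∞} {M : ATm 0}
    {E E' : CTm 0}
    (hV : ∀ {a b v E E'}, V a v E → a ≤ b → CLe CCtx.nil (pot A) E E' → V b v E')
    (h : TermClause A V a M E) (hab : a ≤ b) (hE : CLe CCtx.nil (cpx A) E E') :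
    TermClause A V b M E' := by
  refine ⟨h.1.mono hab, hE.wellTyped.2, fun n r v hev => ?_⟩
  obtain ⟨hc, a', ha', hv⟩ := h.2.2 n r v hev
  obtain ⟨b', hab', hb'⟩ := exists_credit_eq (c := a') (x := credit b + r)
    (ha' ▸ add_le_add_left (credit_mono hab) r)
  exact ⟨hc.trans (.fst_congr hE), b', hb', hV hv hab' (.snd_congr hE)⟩

theorem NatClause.mono {v : ATm 0} {E E' : CTm 0} (h : NatClause v E)
    (hE : CLe CCtx.nil .nat E E') : NatClause v E' := by
  cases h with
  | zero h => exact .zero (h.trans hE)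
  | succ h h' => exact .succ (h.trans hE) h'

theorem ListClause.mono_credit {A : Ty} {V : ℕ∞ → ATm 0 → CTm 0 → Prop} {a b : ℕ∞}
    {v : ATm 0} {E : CTm 0} (h : ListClause A V a v E) (hab : a ≤ b) : ListClause A V b v E := by
  induction h generalizing b with
  | nil h => exact .nil h
  | cons h h₁ _ ih =>
    obtain ⟨t, rfl⟩ := le_iff_exists_add.1 hab
    rw [add_assoc]
    exact .cons h h₁ (ih le_self_add)

theorem ListClause.mono {A : Ty} {V : ℕ∞ → ATm 0 → CTm 0 → Prop} {a b : ℕ∞}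
    {v : ATm 0} {E E' : CTm 0} (h : ListClause A V a v E) (hab : a ≤ b)
    (hE : CLe CCtx.nil (.list (pot A)) E E') : ListClause A V b v E' := by
  replace h := h.mono_credit hab
  cases h with
  | nil h => exact .nil (h.trans hE)
  | cons h h₁ h₂ => exact .cons (h.trans hE) h₁ h₂

/-- A value stays bounded when it has more credits available and its bound grows. -/
theorem ValRel.mono {A : Ty} {a b : ℕ∞} {v : ATm 0} {E E' : CTm 0} (h : ValRel A a v E)
    (hab : a ≤ b) (hE : CLe CCtx.nil (pot A) E E') : ValRel A b v E' := by
  have hty := h.closedTy.mono hab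
  have hE' := hE.wellTyped.2
  induction A generalizing a b v E E' with
  | one => exact ⟨hty, hE', h.2.2.1, h.2.2.2.trans hE⟩
  | tensor A B ihA ihB =>
    obtain ⟨-, -, v₁, v₂, rfl, a₁, a₂, rfl, h₁, h₂⟩ := h
    obtain ⟨t, rfl⟩ := le_iff_exists_add.1 hab
    exact ⟨hty, hE', v₁, v₂, rfl, a₁, a₂ + t, (add_assoc _ _ _).symm,
      ihA h₁ le_rfl (.fst_congr hE) h₁.closedTy (.fst hE'),
      ihB h₂ le_self_add (.snd_congr hE) (h₂.closedTy.mono le_self_add) (.snd hE')⟩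
  | plus A B ihA ihB =>
    obtain ⟨-, -, ⟨w, F, rfl, hF, h⟩ | ⟨w, F, rfl, hF, h⟩⟩ := h
    · exact ⟨hty, hE', .inl ⟨w, F, rfl, hF.trans hE,
        ihA h hab (.refl h.cHasTy) (h.closedTy.mono hab) h.cHasTy⟩⟩
    · exact ⟨hty, hE', .inr ⟨w, F, rfl, hF.trans hE,
        ihB h hab (.refl h.cHasTy) (h.closedTy.mono hab) h.cHasTy⟩⟩
  | amp A B ihA ihB =>
    obtain ⟨-, -, M, N, rfl, h₁, h₂⟩ := h
    exact ⟨hty, hE', M, N, rfl,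
      h₁.mono (fun h hab hE => ihA h hab hE (h.closedTy.mono hab) hE.wellTyped.2) hab
        (.fst_congr hE),
      h₂.mono (fun h hab hE => ihB h hab hE (h.closedTy.mono hab) hE.wellTyped.2) hab
        (.snd_congr hE)⟩
  | lolli A B _ ihB =>
    obtain ⟨-, -, M, rfl, h⟩ := h
    exact ⟨hty, hE', M, rfl, fun w d F hw => (h w d F hw).mono
      (fun h hab hE => ihB h hab hE (h.closedTy.mono hab) hE.wellTyped.2)
      (add_le_add_left hab d) (.app_congr hE hw.cHasTy)⟩
  | bang k l A ih =>
    obtain ⟨-, -, w, rfl, d, hd, h⟩ := h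
    exact ⟨hty, hE', w, rfl, d, hd.trans hab, ih h le_rfl hE h.closedTy hE'⟩
  | nat => exact ⟨hty, hE', h.2.2.mono hE⟩
  | list A => exact ⟨hty, hE', h.2.2.mono hab hE⟩

theorem TermRel.mono {A : Ty} {a b : ℕ∞} {M : ATm 0} {E E' : CTm 0} (h : TermRel A a M E)
    (hab : a ≤ b) (hE : CLe CCtx.nil (cpx A) E E') : TermRel A b M E' :=
  TermClause.mono ValRel.mono h hab hE

theorem ValRel.app {A B : Ty} {a d : ℕ∞} {M : ATm 1} {w : ATm 0} {E E' : CTm 0}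
    (h : ValRel (.lolli A B) a (.lam M) E) (hw : ValRel A d w E') :
    TermRel B (a + d) (M.inst w) (.app E E') := by
  obtain ⟨-, -, M', hM, h⟩ := h
  cases hM
  exact h w d E' hw

/-! ### Bounding costs and results -/

theorem CLe.const_le_add {c c₁ c₂ : ZInf} {E₁ E₂ : CTm 0} (hc : c ≤ c₁ + c₂)
    (h₁ : CLe CCtx.nil .cost (.const c₁) E₁) (h₂ : CLe CCtx.nil .cost (.const c₂) E₂) :
    CLe CCtx.nil .cost (.const c) (.add E₁ E₂) :=
  (CLe.const hc).trans ((CLe.const_add c₁ c₂).trans (.add_congr h₁ h₂))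

/-- The cost `(n, k r)` is bounded by `k` times a bound of the cost `(n, r)`. -/
theorem CLe.const_le_smul {k : Mult} {n : ℕ} {r : ZInf} {E : CTm 0}
    (h : CLe CCtx.nil .cost (.const (n + r)) E) :
    CLe CCtx.nil .cost (.const (n + scale k r)) (.smul k E) :=
  (CLe.const (natCast_add_scale_le k n r)).trans ((CLe.const_smul k _).trans (.smul_congr h))

/-- A value is bounded by every complexity with nonnegative cost whose potential bounds it. -/
theorem TermRel.of_val {A : Ty} {a : ℕ∞} {v : ATm 0} {P E : CTm 0} (h : ValRel A a v P)
    (hE : CHasTy CCtx.nil E (cpx A)) (hc : CLe CCtx.nil .cost (.const 0) (.fst E))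
    (hp : CLe CCtx.nil (pot A) P (.snd E)) : TermRel A a v E := by
  refine ⟨h.closedTy, hE, fun n r w hev => ?_⟩
  obtain ⟨rfl, rfl, rfl⟩ := h.isVal.eval hev
  refine ⟨?_, a, (add_zero _).symm, h.mono le_rfl hp⟩
  rw [add_zero]
  exact hc

theorem TermRel.of_val_pair {A : Ty} {a : ℕ∞} {v : ATm 0} {P : CTm 0} (h : ValRel A a v P) :
    TermRel A a v (.pair (.const 0) P) :=
  .of_val h (.pair (.const 0) h.cHasTy) (.fst_beta (.const 0) h.cHasTy)
    (.snd_beta (.const 0) h.cHasTy)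

/-- The judgment that the outcome `v` of an evaluation with cost `(n, r)`, started with `a`
credits, is bounded by the complexity `E`. -/
def Outcome (A : Ty) (a : ℕ∞) (n : ℕ) (r : ZInf) (v : ATm 0) (E : CTm 0) : Prop :=
  CLe CCtx.nil .cost (.const ((n : ZInf) + r)) (.fst E) ∧
    ∃ a' : ℕ∞, credit a' = credit a + r ∧ ValRel A a' v (.snd E)

/-- The outcome of a constructor: its cost and its value are bounded separately. -/
theorem Outcome.of_pair {A : Ty} {a : ℕ∞} {n : ℕ} {r : ZInf} {v : ATm 0} {E P : CTm 0}
    (hc : CLe CCtx.nil .cost (.const ((n : ZInf) + r)) E)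
    (hv : ∃ a' : ℕ∞, credit a' = credit a + r ∧ ValRel A a' v P) :
    Outcome A a n r v (.pair E P) := by
  obtain ⟨a', ha', hv⟩ := hv
  exact ⟨hc.trans (.fst_beta hc.wellTyped.2 hv.cHasTy), a', ha',
    hv.mono le_rfl (.snd_beta hc.wellTyped.2 hv.cHasTy)⟩

/-- The outcome of an elimination form.  After a first phase of cost `(n₁, s)`, started with `b`
credits, the term `N` is evaluated.  It needs at most the `b + s` credits that are left. -/
theorem Outcome.addc {C : Ty} {b b' : ℕ∞} {N w : ATm 0} {n₁ n₂ : ℕ} {s r₂ : ZInf}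
    {E₁ E₂ : CTm 0} (hN : TermRel C b' N E₂) (hev : Eval N n₂ r₂ w)
    (hb : credit b' ≤ credit b + s)
    (hc : CLe CCtx.nil .cost (.const ((n₁ : ZInf) + s)) E₁) :
    Outcome C b (n₁ + n₂) (s + r₂) w (CTm.addc E₁ E₂) := by
  obtain ⟨hc₂, c, hcr, hw⟩ := hN.2.2 _ _ _ hev
  obtain ⟨c', hcc', hc'⟩ := exists_credit_eq (c := c) (x := credit b + (s + r₂))
    (by rw [hcr, ← add_assoc]; exact add_le_add_left hb r₂)
  refine .of_pair (.const_le_add (le_of_eq ?_) hc hc₂) ⟨c', hc', hw.mono hcc' (.refl hw.cHasTy)⟩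
  rw [Nat.cast_add]
  exact add_add_add_comm _ _ _ _

/-! ### Recursion on natural numbers -/

/-- The term that `nrec (v, λ N₁, save (λ N₂))` continues with, when `v` is a numeral. -/
def nrecBody (N₁ N₂ : ATm 1) : ATm 0 → ATm 0
  | .succ v => N₂.inst (.pair v (.lam (ATm.weaken (.nrec v (.lam N₁)
      (.save Mult.inf 0 (.lam N₂))))))
  | _ => N₁.inst .unit

theorem Eval.nrec_inv {M N₁ N₂ w : ATm 0} {n : ℕ} {r : ZInf} (h : Eval (.nrec M N₁ N₂) n r w) :
    ∃ v N₁' N₂' n₁ n₂ n₃ n₄ r₁ r₂ r₃ r₄, n = n₁ + n₂ + n₃ + n₄ ∧ r = r₁ + r₂ + r₃ + r₄ ∧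
      Eval M n₁ r₁ v ∧ Eval N₁ n₂ r₂ (.lam N₁') ∧
      Eval N₂ n₃ r₃ (.save Mult.inf 0 (.lam N₂')) ∧ Eval (nrecBody N₁' N₂' v) n₄ r₄ w := by
  cases h with
  | nrec_zero h₁ h₂ h₃ h₄ => exact ⟨_, _, _, _, _, _, _, _, _, _, _, rfl, rfl, h₁, h₂, h₃, h₄⟩
  | nrec_succ h₁ h₂ h₃ h₄ => exact ⟨_, _, _, _, _, _, _, _, _, _, _, rfl, rfl, h₁, h₂, h₃, h₄⟩

theorem CLe.nrecStep_beta {E P : CTm 0} {T : CTy}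
    (hE : CHasTy CCtx.nil E (.arr (.prod .nat (.arr .one T)) T))
    (hP : CHasTy CCtx.nil P (.prod .nat T)) :
    CLe CCtx.nil T (.app E (.pair (.fst P) (.lam (.snd P.weaken)))) (.app E.nrecStep P) := by
  have h : CHasTy CCtx.nil E.nrecStep (.arr (.prod .nat T) T) := hE.nrecStep
  rw [CTm.nrecStep] at h ⊢
  cases h with
  | lam h =>
    have := CLe.lam_beta h hP
    have hi := CTm.inst_weaken E P
    rw [CTm.inst] at this hi
    simp only [CTm.subst, hi] at this
    exact this

/-- Budget bookkeeping for the step of a recursion: `∞ · d ≤ h` means that `h` credits suffice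
for the step function, which needs `d` of them, and for all further steps. -/
theorem add_le_of_top_mul_le {d h : ℕ∞} (hd : ⊤ * d ≤ h) : d + h ≤ h := by
  rcases eq_or_ne d 0 with rfl | h0
  · rw [zero_add]
  · rw [ENat.top_mul h0, top_le_iff] at hd
    exact hd ▸ le_top

theorem ClosedTy.save_inf {A : Ty} {d h : ℕ∞} {M : ATm 0} (hM : ClosedTy d M A)
    (hd : ⊤ * d ≤ h) : ClosedTy h (.save Mult.inf 0 M) (.bang Mult.inf 0 A) :=
  .save hM (by
    rw [Res.smul_bank, ← Res.bank_add, add_zero]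
    exact Res.bank_mono hd)

theorem NatClause.closedTy {v : ATm 0} {E : CTm 0} (h : NatClause v E) (a : ℕ∞) :
    ClosedTy a v .nat := by
  induction h with
  | zero _ => exact .zero
  | succ _ _ ih => exact .succ ih

/-- The bounding relation for `nrec`, given the one for the term that it continues with. -/
theorem TermRel.nrec_of_body {C : Ty} {a : ℕ∞} {v : ATm 0} {N₁ N₂ : ATm 1} {E : CTm 0}
    (h : TermRel C a (nrecBody N₁ N₂ v) E) (hv : IsVal v)
    (hty : ClosedTy a (.nrec v (.lam N₁) (.save Mult.inf 0 (.lam N₂))) C) :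
    TermRel C a (.nrec v (.lam N₁) (.save Mult.inf 0 (.lam N₂))) E := by
  refine ⟨hty, h.2.1, fun n r w hev => ?_⟩
  obtain ⟨v, N₁', N₂', n₁, n₂, n₃, n₄, r₁, r₂, r₃, r₄, rfl, rfl, h₁, h₂, h₃, h₄⟩ := hev.nrec_inv
  obtain ⟨rfl, rfl, rfl⟩ := hv.eval h₁
  obtain ⟨rfl, rfl, he⟩ := (IsVal.lam N₁).eval h₂
  obtain ⟨rfl, rfl, he'⟩ := (IsVal.save Mult.inf 0 (IsVal.lam N₂)).eval h₃
  cases he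
  cases he'
  simpa using h.2.2 _ _ _ h₄

/-- A constant function `λ z. M` on the unit type is bounded by `λ z. E` if `M` is bounded
by `E`. -/
theorem ValRel.thunk {C : Ty} {a : ℕ∞} {M : ATm 0} {E : CTm 0} (h : TermRel C a M E) :
    ValRel (.lolli .one C) a (.lam M.weaken) (.lam E.weaken) := by
  refine ⟨.lam ((HasTy.weaken h.1 .one).mono ⟨fun i => ?_, le_rfl⟩), .lam (h.2.1.weaken _),
    _, rfl, fun w d F hw => ?_⟩
  · cases i using Fin.cases with
    | zero => exact zero_le
    | succ i => exact le_rfl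
  · rw [ATm.inst_weaken]
    refine h.mono le_self_add ?_
    have := CLe.lam_beta (h.2.1.weaken _) hw.cHasTy
    rwa [CTm.inst_weaken] at this

/-- The recursor on numerals, by induction on the numeral.  All unfoldings share the `b` credits
of the base case, because it is reached at most once, and the `h` credits of the step
function. -/
theorem NatClause.nrecBody_rel {C : Ty} {b d h : ℕ∞} {v : ATm 0} {N₁ N₂ : ATm 1}
    {E E₁ E₂ : CTm 0} (hv : NatClause v E)
    (h₁ : ValRel (.lolli .one C) b (.lam N₁) E₁)
    (h₂ : ValRel (.lolli (.tensor .nat (.lolli .one C)) C) d (.lam N₂) E₂)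
    (hd : ⊤ * d ≤ h) : TermRel C (b + h) (nrecBody N₁ N₂ v) (.nrec E E₁ E₂.nrecStep) := by
  have hE₁ := h₁.cHasTy
  have hE₂ : CHasTy CCtx.nil E₂.nrecStep (.arr (.prod .nat (cpx C)) (cpx C)) :=
    h₂.cHasTy.nrecStep
  have ht := h₁.closedTy
  have ht' := h₂.closedTy
  induction hv with
  | zero hE =>
    have hu : ValRel .one 0 .unit .unit := ⟨.unit, .unit, rfl, .refl .unit⟩
    exact TermRel.mono (h₁.app hu) (by rw [add_zero]; exact le_self_add)
      ((CLe.zero_beta hE₁ hE₂).trans (.nrec_congr hE hE₁ hE₂))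
  | @succ v E E' hE hv ih =>
    have hE' : CHasTy CCtx.nil E' .nat := by
      cases hE.wellTyped.1 with
      | succ h => exact h
    have hty : ClosedTy (b + h) (.nrec v (.lam N₁) (.save Mult.inf 0 (.lam N₂))) C := by
      have := HasTy.nrec (hv.closedTy 0) ht (ht'.save_inf hd)
      rwa [← Res.bank_add, ← Res.bank_add, zero_add] at this
    have ih := ih.nrec_of_body hv.isVal hty
    have hRty := ih.2.1
    set R : CTm 0 := .nrec E' E₁ E₂.nrecStep
    -- `P` is the argument of the extracted step function, `F` that of the step function
    set P : CTm 0 := .pair E' R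
    have hP : CHasTy CCtx.nil P (.prod .nat (cpx C)) := .pair hE' hRty
    have hthunk := ValRel.thunk (ih.mono le_rfl (.snd_beta hE' hRty))
    set F : CTm 0 := .pair (.fst P) (.lam (.snd P.weaken))
    have hF : CHasTy CCtx.nil F (.prod .nat (.arr .one (cpx C))) :=
      .pair (.fst hP) hthunk.cHasTy
    have hpair : ValRel (.tensor .nat (.lolli .one C)) (0 + (b + h)) (.pair v (.lam (ATm.weaken
        (.nrec v (.lam N₁) (.save Mult.inf 0 (.lam N₂)))))) F := by
      refine ⟨?_, hF, _, _, rfl, _, _, rfl, ⟨hv.closedTy 0, .fst hF, ?_⟩, ?_⟩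
      · rw [ClosedTy, Res.bank_add]
        exact .pair (hv.closedTy 0) hthunk.closedTy
      · exact hv.mono ((CLe.fst_beta hE' hRty).trans (.fst_beta (.fst hP) hthunk.cHasTy))
      · exact hthunk.mono le_rfl (.snd_beta (.fst hP) hthunk.cHasTy)
    refine TermRel.mono (h₂.app hpair) ?_ ((CLe.nrecStep_beta h₂.cHasTy hP).trans
      ((CLe.succ_beta hE' hE₁ hE₂).trans (.nrec_congr hE hE₁ hE₂)))
    rw [zero_add, add_left_comm]
    exact add_le_add_right (add_le_of_top_mul_le hd) b

/-! ### Recursion on lists -/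

/-- The term that `lrec (v, λ N₁, save (λ N₂))` continues with, when `v` is a list of values. -/
def lrecBody (N₁ N₂ : ATm 1) : ATm 0 → ATm 0
  | .cons v₁ v₂ => N₂.inst (.pair v₁ (.ampPair v₂ (.lrec v₂ (.lam N₁)
      (.save Mult.inf 0 (.lam N₂)))))
  | _ => N₁.inst .unit

theorem Eval.lrec_inv {M N₁ N₂ w : ATm 0} {n : ℕ} {r : ZInf} (h : Eval (.lrec M N₁ N₂) n r w) :
    ∃ v N₁' N₂' n₁ n₂ n₃ n₄ r₁ r₂ r₃ r₄, n = n₁ + n₂ + n₃ + n₄ ∧ r = r₁ + r₂ + r₃ + r₄ ∧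
      Eval M n₁ r₁ v ∧ Eval N₁ n₂ r₂ (.lam N₁') ∧
      Eval N₂ n₃ r₃ (.save Mult.inf 0 (.lam N₂')) ∧ Eval (lrecBody N₁' N₂' v) n₄ r₄ w := by
  cases h with
  | lrec_nil h₁ h₂ h₃ h₄ => exact ⟨_, _, _, _, _, _, _, _, _, _, _, rfl, rfl, h₁, h₂, h₃, h₄⟩
  | lrec_cons h₁ h₂ h₃ h₄ => exact ⟨_, _, _, _, _, _, _, _, _, _, _, rfl, rfl, h₁, h₂, h₃, h₄⟩

theorem CLe.lrecStep_beta {E P : CTm 0} {T T' : CTy}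
    (hE : CHasTy CCtx.nil E (.arr (.prod T' (.prod (.prod .cost (.list T')) T)) T))
    (hP : CHasTy CCtx.nil P (.prod T' (.prod (.list T') T))) :
    CLe CCtx.nil T (.app E (.pair (.fst P)
      (.pair (.pair (.const 0) (.fst (.snd P))) (.snd (.snd P))))) (.app E.lrecStep P) := by
  have h : CHasTy CCtx.nil E.lrecStep (.arr (.prod T' (.prod (.list T') T)) T) := hE.lrecStep
  rw [CTm.lrecStep] at h ⊢
  cases h with
  | lam h =>
    have := CLe.lam_beta h hP
    have hi := CTm.inst_weaken E P
    rw [CTm.inst] at this hi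
    simp only [CTm.subst, hi] at this
    exact this

/-- The bounding relation for `lrec`, given the one for the term that it continues with. -/
theorem TermRel.lrec_of_body {C : Ty} {a : ℕ∞} {v : ATm 0} {N₁ N₂ : ATm 1} {E : CTm 0}
    (h : TermRel C a (lrecBody N₁ N₂ v) E) (hv : IsVal v)
    (hty : ClosedTy a (.lrec v (.lam N₁) (.save Mult.inf 0 (.lam N₂))) C) :
    TermRel C a (.lrec v (.lam N₁) (.save Mult.inf 0 (.lam N₂))) E := by
  refine ⟨hty, h.2.1, fun n r w hev => ?_⟩
  obtain ⟨v, N₁', N₂', n₁, n₂, n₃, n₄, r₁, r₂, r₃, r₄, rfl, rfl, h₁, h₂, h₃, h₄⟩ := hev.lrec_inv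
  obtain ⟨rfl, rfl, rfl⟩ := hv.eval h₁
  obtain ⟨rfl, rfl, he⟩ := (IsVal.lam N₁).eval h₂
  obtain ⟨rfl, rfl, he'⟩ := (IsVal.save Mult.inf 0 (IsVal.lam N₂)).eval h₃
  cases he
  cases he'
  simpa using h.2.2 _ _ _ h₄

theorem ListClause.closedTy {A : Ty} {a : ℕ∞} {v : ATm 0} {E : CTm 0}
    (h : ListClause A (ValRel A) a v E) : ClosedTy a v (.list A) := by
  induction h with
  | nil _ => exact .nil
  | cons _ h₁ _ ih =>
    rw [ClosedTy, Res.bank_add]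
    exact .cons h₁.closedTy ih

/-- The recursor on lists, by induction on the list.  Besides the credits `b` and `h` as for
numerals, there are those stored in the list; the lazy pair of the tail and its recursive result
may use the same credits for both components, since only one of them is ever evaluated. -/
theorem ListClause.lrecBody_rel {A C : Ty} {a b d h : ℕ∞} {v : ATm 0} {N₁ N₂ : ATm 1}
    {E E₁ E₂ : CTm 0} (hv : ListClause A (ValRel A) a v E)
    (h₁ : ValRel (.lolli .one C) b (.lam N₁) E₁)
    (h₂ : ValRel (.lolli (.tensor A (.amp (.list A) C)) C) d (.lam N₂) E₂)
    (hd : ⊤ * d ≤ h) : TermRel C (a + b + h) (lrecBody N₁ N₂ v) (.lrec E E₁ E₂.lrecStep) := by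
  have hE₁ := h₁.cHasTy
  have hE₂' := h₂.cHasTy
  have hE₂ : CHasTy CCtx.nil E₂.lrecStep
      (.arr (.prod (pot A) (.prod (.list (pot A)) (cpx C))) (cpx C)) := h₂.cHasTy.lrecStep
  have ht := h₁.closedTy
  have ht' := h₂.closedTy
  induction hv with
  | @nil a E hE =>
    have hu : ValRel .one 0 .unit .unit := ⟨.unit, .unit, rfl, .refl .unit⟩
    exact TermRel.mono (h₁.app hu)
      (by rw [add_zero, add_assoc]; exact le_self_add.trans le_add_self)
      ((CLe.nil_beta hE₁ hE₂).trans (.lrec_congr hE hE₁ hE₂))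
  | @cons a₁ a₂ v₁ v₂ E F₁ F₂ hE hv₁ hv₂ ih =>
    have hF₁ := hv₁.cHasTy
    have hF₂ : CHasTy CCtx.nil F₂ (.list (pot A)) := by
      cases hE.wellTyped.1 with
      | cons _ h => exact h
    have hty : ClosedTy (a₂ + b + h) (.lrec v₂ (.lam N₁) (.save Mult.inf 0 (.lam N₂))) C := by
      rw [ClosedTy, Res.bank_add, Res.bank_add]
      exact .lrec hv₂.closedTy ht (ht'.save_inf hd)
    have hval := hv₂.isVal ValRel.isVal
    have ih := ih.lrec_of_body hval hty
    have hRty := ih.2.1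
    set R : CTm 0 := .lrec F₂ E₁ E₂.lrecStep
    -- `P` is the argument of the extracted step function, `(π₁ P, G)` that of the step function
    set P : CTm 0 := .pair F₁ (.pair F₂ R)
    have hSty : CHasTy CCtx.nil (.pair F₂ R) (.prod (.list (pot A)) (cpx C)) := .pair hF₂ hRty
    have hPty : CHasTy CCtx.nil P (.prod (pot A) (.prod (.list (pot A)) (cpx C))) :=
      .pair hF₁ hSty
    have hsnd := CLe.snd_beta hF₁ hSty
    have hpF₂ : CLe CCtx.nil (.list (pot A)) F₂ (.fst (.snd P)) :=
      (CLe.fst_beta hF₂ hRty).trans (.fst_congr hsnd)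
    have hpR : CLe CCtx.nil (cpx C) R (.snd (.snd P)) :=
      (CLe.snd_beta hF₂ hRty).trans (.snd_congr hsnd)
    set G₁ : CTm 0 := .pair (.const 0) (.fst (.snd P))
    set G : CTm 0 := .pair G₁ (.snd (.snd P))
    have hG₁ty : CHasTy CCtx.nil G₁ (cpx (.list A)) := .pair (.const 0) (.fst (.snd hPty))
    have hG₂ty : CHasTy CCtx.nil (.snd (.snd P)) (cpx C) := .snd (.snd hPty)
    have hGty : CHasTy CCtx.nil G (pot (.amp (.list A) C)) := .pair hG₁ty hG₂ty
    have htail : ValRel (.list A) (a₂ + b + h) v₂ (.fst (.snd P)) :=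
      have hv₂' := (hv₂.mono_credit (b := a₂ + b + h)
        (by rw [add_assoc]; exact le_self_add)).mono le_rfl hpF₂
      ⟨hv₂'.closedTy, hpF₂.wellTyped.2, hv₂'⟩
    have hfst : TermRel (.list A) (a₂ + b + h) v₂ (.fst G) :=
      (TermRel.of_val_pair htail).mono le_rfl (.fst_beta hG₁ty hG₂ty)
    have hrec : TermRel C (a₂ + b + h)
        (.lrec v₂ (.lam N₁) (.save Mult.inf 0 (.lam N₂))) (.snd G) :=
      ih.mono le_rfl (hpR.trans (.snd_beta hG₁ty hG₂ty))
    have hamp : ValRel (.amp (.list A) C) (a₂ + b + h)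
        (.ampPair v₂ (.lrec v₂ (.lam N₁) (.save Mult.inf 0 (.lam N₂)))) G :=
      ⟨.ampPair hfst.1 hrec.1, hGty, _, _, rfl, hfst, hrec⟩
    have hF := CHasTy.fst hPty
    have hpair : ValRel (.tensor A (.amp (.list A) C)) (a₁ + (a₂ + b + h))
        (.pair v₁ (.ampPair v₂ (.lrec v₂ (.lam N₁) (.save Mult.inf 0 (.lam N₂)))))
        (.pair (.fst P) G) := by
      refine ⟨?_, .pair hF hGty, _, _, rfl, _, _, rfl, ?_, ?_⟩
      · rw [ClosedTy, Res.bank_add]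
        exact .pair hv₁.closedTy hamp.closedTy
      · exact hv₁.mono le_rfl ((CLe.fst_beta hF₁ hSty).trans (.fst_beta hF hGty))
      · exact hamp.mono le_rfl (.snd_beta hF hGty)
    refine TermRel.mono (h₂.app hpair) ?_ ((CLe.lrecStep_beta hE₂' hPty).trans
      ((CLe.cons_beta hF₁ hF₂ hE₁ hE₂).trans (.lrec_congr hE hE₁ hE₂)))
    calc d + (a₁ + (a₂ + b + h)) = a₁ + a₂ + b + (d + h) := by abel
      _ ≤ a₁ + a₂ + b + h := add_le_add_right (add_le_of_top_mul_le hd) _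

/-! ### The fundamental lemma -/

/-- Related closing substitutions are well typed, so that only evaluations are left to consider
in a proof of the bounding relation for a typed open term. -/
theorem OpenRel.of_outcome {n : ℕ} {Γ : Ctx n} {f : Res n} {M : ATm n} {A : Ty}
    (h : HasTy Γ f M A)
    (hev : ∀ (σ : Fin n → ℕ∞) (θ : Fin n → ATm 0) (Θ : Fin n → CTm 0), SubRel Γ σ θ Θ →
      ∀ (t : ℕ) (r : ZInf) (v : ATm 0), Eval (M.subst θ) t r v →
        Outcome A (f.eval σ) t r v ((extract M).subst Θ)) :
    OpenRel Γ f M A (extract M) := fun σ θ Θ hθ =>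
  ⟨h.subst_closed fun i => (hθ i).closedTy, (CHasTy.extract h).subst fun i => (hθ i).cHasTy,
    hev σ θ Θ hθ⟩

theorem SubRel.cons {n : ℕ} {Γ : Ctx n} {σ : Fin n → ℕ∞} {θ : Fin n → ATm 0}
    {Θ : Fin n → CTm 0} {A : Ty} {a : ℕ∞} {v : ATm 0} {E : CTm 0} (hθ : SubRel Γ σ θ Θ)
    (h : ValRel A a v E) : SubRel (Γ.ext A) (Fin.cons a σ) (Fin.cons v θ) (Fin.cons E Θ) := by
  intro i
  cases i using Fin.cases with
  | zero => exact h
  | succ i => exact hθ i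

/-- The bounding relation for the body of a binder, at related instances of the variable. -/
theorem OpenRel.inst {n : ℕ} {Γ : Ctx n} {f : Res n} {A C : Ty} {N : ATm (n + 1)}
    {E : CTm (n + 1)} {k : ℕ∞} (h : OpenRel (Γ.ext A) (f.ext k) N C E)
    {σ : Fin n → ℕ∞} {θ : Fin n → ATm 0} {Θ : Fin n → CTm 0} (hθ : SubRel Γ σ θ Θ)
    {a : ℕ∞} {v : ATm 0} {P : CTm 0} (hv : ValRel A a v P) :
    TermRel C (f.eval σ + k * a) ((N.subst (ATm.lift θ)).inst v) (E.subst (Fin.cons P Θ)) := by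
  rw [ATm.inst_subst_lift, ← Res.eval_ext]
  exact h _ _ _ (hθ.cons hv)

/-- Every extracted recurrence is a bound of its term. -/
theorem HasTy.openRel {n : ℕ} {Γ : Ctx n} {f : Res n} {M : ATm n} {A : Ty}
    (h : HasTy Γ f M A) : OpenRel Γ f M A (extract M) := by
  induction h with
  | var i hi =>
    intro σ θ Θ hθ
    refine (TermRel.of_val_pair (hθ i)).mono ?_
      (.refl (.pair (.const 0) (hθ i).cHasTy))
    rw [← Res.eval_var i σ]
    exact Res.eval_mono hi σ
  | unit =>
    intro σ θ Θ hθ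
    exact .of_val_pair (A := .one) ⟨.unit, .unit, rfl, .refl .unit⟩
  | pair h₁ h₂ ih₁ ih₂ =>
    refine .of_outcome (.pair h₁ h₂) fun σ θ Θ hθ t r v hev => ?_
    cases hev with
    | pair e₁ e₂ =>
      obtain ⟨hc₁, a₁, ha₁, hv₁⟩ := (ih₁ σ θ Θ hθ).2.2 _ _ _ e₁
      obtain ⟨hc₂, a₂, ha₂, hv₂⟩ := (ih₂ σ θ Θ hθ).2.2 _ _ _ e₂
      refine .of_pair (.const_le_add (le_of_eq ?_) hc₁ hc₂) ⟨a₁ + a₂, ?_, ?_⟩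
      · rw [Nat.cast_add]
        exact add_add_add_comm _ _ _ _
      · rw [credit_add, ha₁, ha₂, Res.eval_add, credit_add]
        exact add_add_add_comm _ _ _ _
      · refine ⟨?_, .pair hv₁.cHasTy hv₂.cHasTy, _, _, rfl, a₁, a₂, rfl,
          hv₁.mono le_rfl (.fst_beta hv₁.cHasTy hv₂.cHasTy),
          hv₂.mono le_rfl (.snd_beta hv₁.cHasTy hv₂.cHasTy)⟩
        rw [ClosedTy, Res.bank_add]
        exact .pair hv₁.closedTy hv₂.closedTy
  | @split n Γ f g k M N A B C h₁ h₂ ih₁ ih₂ =>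
    refine .of_outcome (.split h₁ h₂) fun σ θ Θ hθ t r v hev => ?_
    cases hev with
    | split e₁ e₂ =>
      obtain ⟨hc, a, ha, -, -, _, _, hp, a₁, a₂, rfl, hv₁, hv₂⟩ := (ih₁ σ θ Θ hθ).2.2 _ _ _ e₁
      cases hp
      have hN := ih₂ _ _ _ ((hθ.cons hv₁).cons hv₂)
      rw [← ATm.inst₂_subst_lift, Res.eval_ext, Res.eval_ext] at hN
      rw [extract, CTm.addc, CTm.subst]
      simp only [CTm.subst, CTm.subst_inst₂]
      refine Outcome.addc hN e₂ ?_ hc.const_le_smul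
      rw [Res.eval_add, Res.eval_smul, add_assoc, ← mul_add, credit_add, credit_add, add_assoc]
      exact add_le_add_right (credit_mul_le k ha) _
  | inl h ih =>
    refine .of_outcome (.inl h) fun σ θ Θ hθ t r v hev => ?_
    cases hev with
    | inl e =>
      obtain ⟨hc, a, ha, hv⟩ := (ih σ θ Θ hθ).2.2 _ _ _ e
      exact .of_pair hc ⟨a, ha, .inl hv.closedTy, .inl hv.cHasTy,
        .inl ⟨_, _, rfl, .refl (.inl hv.cHasTy), hv⟩⟩
  | inr h ih =>
    refine .of_outcome (.inr h) fun σ θ Θ hθ t r v hev => ?_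
    cases hev with
    | inr e =>
      obtain ⟨hc, a, ha, hv⟩ := (ih σ θ Θ hθ).2.2 _ _ _ e
      exact .of_pair hc ⟨a, ha, .inr hv.closedTy, .inr hv.cHasTy,
        .inr ⟨_, _, rfl, .refl (.inr hv.cHasTy), hv⟩⟩
  | @case n Γ f g k M N₁ N₂ A B C h₁ h₂ h₃ ih₁ ih₂ ih₃ =>
    refine .of_outcome (.case h₁ h₂ h₃) fun σ θ Θ hθ t r v hev => ?_
    have hΘ : ∀ i, CHasTy CCtx.nil (Θ i) (potCtx Γ i) := fun i => (hθ i).cHasTy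
    have hE₁ : CHasTy (CCtx.nil.ext (pot A)) ((extract N₁).subst (CTm.lift Θ)) (cpx C) :=
      (potCtx_ext Γ A ▸ CHasTy.extract h₂ : CHasTy _ _ _).subst (CHasTy.lift hΘ _)
    have hE₂ : CHasTy (CCtx.nil.ext (pot B)) ((extract N₂).subst (CTm.lift Θ)) (cpx C) :=
      (potCtx_ext Γ B ▸ CHasTy.extract h₃ : CHasTy _ _ _).subst (CHasTy.lift hΘ _)
    -- both branches run on the credits of the scrutinee's result, taken `k` times
    have hbudget {a : ℕ∞} {r₁ : ZInf} (ha : credit a = credit (f.eval σ) + r₁) :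
        credit (g.eval σ + k.1 * a) ≤ credit ((g + k.1 • f).eval σ) + scale k r₁ := by
      rw [Res.eval_add, Res.eval_smul, credit_add, credit_add, add_assoc]
      exact add_le_add_right (credit_mul_le k ha) _
    cases hev with
    | case_inl e₁ e₂ =>
      obtain ⟨hc, a, ha, -, -, ⟨w, E', hw, hE, hv⟩ | ⟨w, E', hw, hE, hv⟩⟩ :=
        (ih₁ σ θ Θ hθ).2.2 _ _ _ e₁ <;> cases hw
      have hN := ih₂.inst hθ hv
      rw [← CTm.inst_subst_lift] at hN
      exact .addc (hN.mono le_rfl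
        ((CLe.inl_beta hv.cHasTy hE₁ hE₂).trans (.case_congr hE hE₁ hE₂))) e₂ (hbudget ha)
        hc.const_le_smul
    | case_inr e₁ e₂ =>
      obtain ⟨hc, a, ha, -, -, ⟨w, E', hw, hE, hv⟩ | ⟨w, E', hw, hE, hv⟩⟩ :=
        (ih₁ σ θ Θ hθ).2.2 _ _ _ e₁ <;> cases hw
      have hN := ih₃.inst hθ hv
      rw [← CTm.inst_subst_lift] at hN
      exact .addc (hN.mono le_rfl
        ((CLe.inr_beta hv.cHasTy hE₁ hE₂).trans (.case_congr hE hE₁ hE₂))) e₂ (hbudget ha)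
        hc.const_le_smul
  | @ampPair n Γ f M N A B h₁ h₂ ih₁ ih₂ =>
    intro σ θ Θ hθ
    have hM := ih₁ σ θ Θ hθ
    have hN := ih₂ σ θ Θ hθ
    exact .of_val_pair (A := .amp A B) ⟨.ampPair hM.1 hN.1, .pair hM.2.1 hN.2.1, _, _, rfl,
      hM.mono le_rfl (.fst_beta hM.2.1 hN.2.1), hN.mono le_rfl (.snd_beta hM.2.1 hN.2.1)⟩
  | fst h ih =>
    refine .of_outcome (.fst h) fun σ θ Θ hθ t r v hev => ?_
    cases hev with
    | fst e₁ e₂ =>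
      obtain ⟨hc, a, ha, -, -, _, _, hp, hM, -⟩ := (ih σ θ Θ hθ).2.2 _ _ _ e₁
      cases hp
      exact .addc hM e₂ ha.le hc
  | snd h ih =>
    refine .of_outcome (.snd h) fun σ θ Θ hθ t r v hev => ?_
    cases hev with
    | snd e₁ e₂ =>
      obtain ⟨hc, a, ha, -, -, _, _, hp, -, hN⟩ := (ih σ θ Θ hθ).2.2 _ _ _ e₁
      cases hp
      exact .addc hN e₂ ha.le hc
  | @lam n Γ f M A B h ih =>
    intro σ θ Θ hθ
    have hΘ : ∀ i, CHasTy CCtx.nil (Θ i) (potCtx Γ i) := fun i => (hθ i).cHasTy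
    have hE : CHasTy (CCtx.nil.ext (pot A)) ((extract M).subst (CTm.lift Θ)) (cpx B) :=
      (potCtx_ext Γ A ▸ CHasTy.extract h : CHasTy _ _ _).subst (CHasTy.lift hΘ _)
    refine .of_val_pair (A := .lolli A B) ⟨(HasTy.lam h).subst_closed fun i => (hθ i).closedTy,
      .lam hE, _, rfl, fun w d E' hw => ?_⟩
    have hM := ih.inst hθ hw
    rw [← CTm.inst_subst_lift, one_mul] at hM
    exact hM.mono le_rfl (.lam_beta hE hw.cHasTy)
  | app h₁ h₂ ih₁ ih₂ =>
    refine .of_outcome (.app h₁ h₂) fun σ θ Θ hθ t r v hev => ?_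
    cases hev with
    | app e₁ e₂ e₃ =>
      obtain ⟨hc₁, a₁, ha₁, hv₁⟩ := (ih₁ σ θ Θ hθ).2.2 _ _ _ e₁
      obtain ⟨hc₂, a₂, ha₂, hv₂⟩ := (ih₂ σ θ Θ hθ).2.2 _ _ _ e₂
      refine .addc (hv₁.app hv₂) e₃ ?_ (.const_le_add ?_ hc₁ hc₂)
      · rw [credit_add, ha₁, ha₂, Res.eval_add, credit_add]
        exact (add_add_add_comm _ _ _ _).le
      · rw [Nat.cast_add]
        exact (add_add_add_comm _ _ _ _).le
  | @save n Γ f g k l M A h hg ih =>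
    refine .of_outcome (.save h hg) fun σ θ Θ hθ t r v hev => ?_
    cases hev with
    | @save _ _ _ v _ r e =>
      obtain ⟨hc, a, ha, hv⟩ := (ih σ θ Θ hθ).2.2 _ _ _ e
      -- the credits left after the evaluation cover `k` copies of the value and the stored `l`
      have hle : credit (k.1 * a + l) ≤ credit (g.eval σ) + scale k r := by
        have hg := credit_mono (Res.eval_mono hg σ)
        rw [Res.eval_add, Res.eval_smul, Res.eval_bank, credit_add] at hg
        rw [credit_add]
        calc credit (k.1 * a) + credit l
            ≤ credit (k.1 * f.eval σ) + scale k r + credit l :=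
              add_le_add_left (credit_mul_le k ha) _
          _ = credit (k.1 * f.eval σ) + credit l + scale k r := add_right_comm _ _ _
          _ ≤ _ := add_le_add_left hg _
      obtain ⟨a', haa', ha'⟩ := exists_credit_eq hle
      refine .of_pair hc.const_le_smul ⟨a', ha', ?_, hv.cHasTy, v, rfl, a, haa', hv⟩
      refine .save hv.closedTy ?_
      rw [Res.smul_bank, ← Res.bank_add]
      exact Res.bank_mono haa'
  | @transfer n Γ f g k' k l M N A C h₁ h₂ ih₁ ih₂ =>
    refine .of_outcome (.transfer h₁ h₂) fun σ θ Θ hθ t r v hev => ?_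
    cases hev with
    | transfer e₁ e₂ =>
      obtain ⟨hc, a, ha, -, -, _, hp, d, hd, hv⟩ := (ih₁ σ θ Θ hθ).2.2 _ _ _ e₁
      cases hp
      have hN := ih₂.inst hθ hv
      rw [extract, CTm.addc, CTm.subst]
      simp only [CTm.subst, CTm.subst_inst]
      refine Outcome.addc hN e₂ ?_ hc.const_le_smul
      rw [Res.eval_add, Res.eval_add, Res.eval_smul, Res.eval_bank, add_assoc, mul_assoc,
        ← mul_add, add_comm l, credit_add, credit_add, add_assoc]
      exact add_le_add_right
        ((credit_mono (mul_le_mul_right hd k'.1)).trans (credit_mul_le k' ha)) _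
  | tick h ih =>
    refine .of_outcome (.tick h) fun σ θ Θ hθ t r v hev => ?_
    cases hev with
    | tick e =>
      have := Outcome.addc (n₁ := 1) (s := 0) (E₁ := .const 1) (ih σ θ Θ hθ) e
        (add_zero _).ge (.const (by simp))
      rwa [zero_add, add_comm] at this
  | @create n Γ f l M A h ih =>
    refine .of_outcome (.create h) fun σ θ Θ hθ t r v hev => ?_
    cases hev with
    | create e =>
      have := Outcome.addc (b := f.eval σ) (n₁ := 0) (s := credit l) (E₁ := .const (credit l))
        (ih σ θ Θ hθ) e (by rw [Res.eval_add, Res.eval_bank, credit_add]) (.const (by simp))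
      rwa [zero_add, add_comm (credit l)] at this
  | @spend n Γ f l M A h ih =>
    refine .of_outcome (.spend h) fun σ θ Θ hθ t r v hev => ?_
    cases hev with
    | spend e =>
      have := Outcome.addc (n₁ := 0) (s := negCredit l) (E₁ := .const (negCredit l))
        (ih σ θ Θ hθ) e (credit_le_add_negCredit _ l) (.const (by simp))
      rw [zero_add, add_comm (negCredit l)] at this
      rwa [Res.eval_add, Res.eval_bank]
  | zero =>
    intro σ θ Θ hθ
    exact .of_val_pair (A := .nat) ⟨.zero, .zero, .zero (.refl .zero)⟩
  | succ h ih =>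
    refine .of_outcome (.succ h) fun σ θ Θ hθ t r v hev => ?_
    cases hev with
    | succ e =>
      obtain ⟨hc, a, ha, hv⟩ := (ih σ θ Θ hθ).2.2 _ _ _ e
      exact .of_pair hc ⟨a, ha, .succ hv.closedTy, .succ hv.cHasTy,
        .succ (.refl (.succ hv.cHasTy)) hv.2.2⟩
  | @nrec n Γ f g h M N₁ N₂ C h₁ h₂ h₃ ih₁ ih₂ ih₃ =>
    refine .of_outcome (.nrec h₁ h₂ h₃) fun σ θ Θ hθ t r v hev => ?_
    obtain ⟨u, N₁', N₂', n₁, n₂, n₃, n₄, r₁, r₂, r₃, r₄, rfl, rfl, e₁, e₂, e₃, e₄⟩ :=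
      hev.nrec_inv
    obtain ⟨hc₁, a₁, ha₁, hv₁⟩ := (ih₁ σ θ Θ hθ).2.2 _ _ _ e₁
    obtain ⟨hc₂, a₂, ha₂, hv₂⟩ := (ih₂ σ θ Θ hθ).2.2 _ _ _ e₂
    obtain ⟨hc₃, a₃, ha₃, -, -, _, hp, d, hd, hv₃⟩ := (ih₃ σ θ Θ hθ).2.2 _ _ _ e₃
    cases hp
    rw [add_zero] at hd
    have hbody := hv₁.2.2.nrecBody_rel hv₂ hv₃ hd
    rw [extract_nrec_subst]
    -- the credits `a₁` left by the scrutinee are not needed, since a numeral stores none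
    refine .addc (hbody.mono (b := a₁ + (a₂ + a₃)) le_add_self (.refl hbody.2.1)) e₄ ?_
      (.const_le_add ?_ (.const_le_add le_rfl hc₁ hc₂) hc₃)
    · rw [credit_add, credit_add, ha₁, ha₂, ha₃, Res.eval_add, Res.eval_add, credit_add,
        credit_add]
      exact le_of_eq (by abel)
    · push_cast
      exact le_of_eq (by abel)
  | nil =>
    intro σ θ Θ hθ
    exact .of_val_pair (A := .list _) ⟨.nil, .nil, .nil (.refl .nil)⟩
  | cons h₁ h₂ ih₁ ih₂ =>
    refine .of_outcome (.cons h₁ h₂) fun σ θ Θ hθ t r v hev => ?_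
    cases hev with
    | cons e₁ e₂ =>
      obtain ⟨hc₁, a₁, ha₁, hv₁⟩ := (ih₁ σ θ Θ hθ).2.2 _ _ _ e₁
      obtain ⟨hc₂, a₂, ha₂, hv₂⟩ := (ih₂ σ θ Θ hθ).2.2 _ _ _ e₂
      refine .of_pair (.const_le_add (le_of_eq ?_) hc₁ hc₂) ⟨a₁ + a₂, ?_, ?_⟩
      · rw [Nat.cast_add]
        exact add_add_add_comm _ _ _ _
      · rw [credit_add, ha₁, ha₂, Res.eval_add, credit_add]
        exact add_add_add_comm _ _ _ _
      · refine ⟨?_, .cons hv₁.cHasTy hv₂.cHasTy,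
          .cons (.refl (.cons hv₁.cHasTy hv₂.cHasTy)) hv₁ hv₂.2.2⟩
        rw [ClosedTy, Res.bank_add]
        exact .cons hv₁.closedTy hv₂.closedTy
  | @lrec n Γ f g h M N₁ N₂ A C h₁ h₂ h₃ ih₁ ih₂ ih₃ =>
    refine .of_outcome (.lrec h₁ h₂ h₃) fun σ θ Θ hθ t r v hev => ?_
    obtain ⟨u, N₁', N₂', n₁, n₂, n₃, n₄, r₁, r₂, r₃, r₄, rfl, rfl, e₁, e₂, e₃, e₄⟩ :=
      hev.lrec_inv
    obtain ⟨hc₁, a₁, ha₁, hv₁⟩ := (ih₁ σ θ Θ hθ).2.2 _ _ _ e₁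
    obtain ⟨hc₂, a₂, ha₂, hv₂⟩ := (ih₂ σ θ Θ hθ).2.2 _ _ _ e₂
    obtain ⟨hc₃, a₃, ha₃, -, -, _, hp, d, hd, hv₃⟩ := (ih₃ σ θ Θ hθ).2.2 _ _ _ e₃
    cases hp
    rw [add_zero] at hd
    have hbody := hv₁.2.2.lrecBody_rel hv₂ hv₃ hd
    rw [extract_lrec_subst]
    refine .addc hbody e₄ ?_ (.const_le_add ?_ (.const_le_add le_rfl hc₁ hc₂) hc₃)
    · rw [credit_add, credit_add, ha₁, ha₂, ha₃, Res.eval_add, Res.eval_add, credit_add,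
        credit_add]
      exact le_of_eq (by abel)
    · push_cast
      exact le_of_eq (by abel)

end

end AmortRec

theorem mainTheorem1 {n : ℕ} (Γ : AmortRec.Ctx n) (f : AmortRec.Res n) (M : AmortRec.ATm n)
    (A : AmortRec.Ty) (h : AmortRec.HasTy Γ f M A) :
    AmortRec.OpenRel Γ f M A (AmortRec.extract M) :=
  h.openRel
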